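/- **Setting.** Fix $T>0$, a filtered probability space $(\Omega,\mathcal F,(\mathcal F_t)_{t\in[0,T]},\mathbb P)$ satisfying the usual conditions, and constants $X_0>0$, $\gamma>0$, $\phi\ge 0$, $\varrho\ge 0$. Write $\mathbb E_t=\mathbb E[\,\cdot\mid\mathcal F_t]$. Let $\mathcal L^2$ be the Hilbert space of progressively measurable processes $u:[0,T]\times\Omega\to\mathbb R$ with $\mathbb E\int_0^T u_t^2\,dt<\infty$ (identified when equal $dt\otimes\mathbb P$-a.e.), with inner product $\langle u,v\rangle=\mathbb E\int_0^T u_tv_t\,dt$. Let $S\in\mathcal L^2$ with $S_T\in L^2(\Omega,\mathcal F_T,\mathbb P)$, let $g\in\mathcal L^2$, and let $\alpha\in\mathcal L^2$ be given by $\alpha_t=\mathbb E_t[S_T-S_t]$. An admissible kernel is a measurable $G:[0,T]^2\to\mathbb R$ with $G(t,s)=0$ for $s>t$ and $\sup_{t\in[0,T]}\int_0^t|G(t,s)|^2ds<\infty$; it induces the bounded operators on $\mathcal L^2$ $$(\mathbf Gu)_t=\int_0^tG(t,s)u_s\,ds,\qquad (\mathbf G^*u)_t=\int_t^TG(s,t)\,\mathbb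 E_t[u_s]\,ds .$$ Fix such a $G$, and let $\mathbf H,\mathbf H^*$ be the operators induced in the same way by the kernel $H(t,s)=(\phi(T-t)+\varrho)\mathbf 1_{\{t>s\}}$. Let $h:\mathbb R\to\mathbb R$ be admissible, i.e. differentiable with bounded derivative, and such that $|h(x)|\le C(1+|x|^\zeta)$ for all $x\in\mathbb R$, for some $C$ and some $0<\zeta<1$. For $u\in\mathcal L^2$ put $Z^u=g+\mathbf Gu$, $X^u_t=X_0+\int_0^tu_s\,ds$, $S^u=S+\frac\gamma2u+h(Z^u)$, $$\mathcal J(u)=\mathbb E\Big[-\int_0^TS^u_tu_t\,dt+X^u_TS_T-\frac\phi2\int_0^T(X^u_t)^2dt-\frac\varrho2(X^u_T)^2\Big],\qquad \mathbf A(u)=h(Z^u)+\mathbf G^*\big(h'(Z^u)u\big).$$ **Theorem.** Assume that $\mathbf A$ is monotone: $\langle u-v,\mathbf A(u)-\mathbf A(v)\rangle\ge0$ for all $u,v\in\mathcal L^2$. Then there is a unique $\hat u\in\mathcal L^2$ with $\mathcal J(\hat u)=\sup_{u\in\mathcal L^2}\mathcal J(u)$. Moreover, $\hat u$ is the unique solution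 in $\mathcal L^2$ of the nonlinear stochastic Fredholm equation $$\gamma\hat u_t+(\mathbf A(\hat u))_t+(\mathbf H\hat u)_t+(\mathbf H^*\hat u)_t=\alpha_t-X_0\big(\phi(T-t)+\varrho\big),\qquad dt\otimes\mathbb P\text{-a.e.}$$ -/

import Mathlib

open MeasureTheory

namespace OptimalExecution

/-- The time horizon `[0, T]`. -/
abbrev Horizon (T : ℝ) : Type := Set.Icc (0 : ℝ) T

/-- Lebesgue measure on `[0, T]`. -/
noncomputable instance (T : ℝ) : MeasureSpace (Horizon T) :=
  Measure.Subtype.measureSpace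

instance (T : ℝ) : IsFiniteMeasure (volume : Measure (Horizon T)) where
  measure_univ_lt_top := by
    rw [Measure.Subtype.volume_univ measurableSet_Icc.nullMeasurableSet]
    exact measure_Icc_lt_top

/-- The terminal time `T`, as a point of `[0, T]`. -/
def terminal {T : ℝ} (hT : 0 < T) : Horizon T := ⟨T, hT.le, le_rfl⟩

/-- Real valued processes on `[0, T] × Ω`. -/
abbrev RealProcess (T : ℝ) (Ω : Type*) : Type _ := Horizon T → Ω → ℝ

section Kernels

variable {T : ℝ} {Ω : Type*}

/-- Admissible Volterra kernels: measurable, `G(t,s) = 0` for `s > t`, and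
`sup_t ∫₀ᵗ |G(t,s)|² ds < ∞`. -/
structure IsAdmissibleKernel (G : Horizon T → Horizon T → ℝ) : Prop where
  measurable : Measurable (Function.uncurry G)
  volterra : ∀ t s, t < s → G t s = 0
  bounded : ∃ C : NNReal, ∀ t, ∫⁻ s in Set.Iic t, ‖G t s‖ₑ ^ 2 ≤ C

/-- Admissible impact functions: differentiable with bounded derivative and of strictly
sublinear growth. -/
structure IsAdmissibleImpact (h : ℝ → ℝ) : Prop where
  differentiable : Differentiable ℝ h
  bounded_deriv : ∃ M : ℝ, ∀ x, |deriv h x| ≤ M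
  sublinear : ∃ ζ : ℝ, 0 < ζ ∧ ζ < 1 ∧ ∃ C : ℝ, ∀ x, |h x| ≤ C * (1 + |x| ^ ζ)

/-- The integral operator `(𝐆u)_t = ∫₀ᵗ G(t,s) u_s ds`. -/
noncomputable def kernelOp (G : Horizon T → Horizon T → ℝ) (u : RealProcess T Ω) :
    RealProcess T Ω :=
  fun t ω => ∫ s in Set.Iic t, G t s * u s ω

/-- The kernel `H(t,s) = (φ (T - t) + ϱ) 1_{t > s}`. -/
noncomputable def inventoryKernel (T φ ϱ : ℝ) : Horizon T → Horizon T → ℝ :=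
  fun t s => if s < t then φ * (T - (t : ℝ)) + ϱ else 0

/-- The distortion `Z^u = g + 𝐆u`. -/
noncomputable def distortion (G : Horizon T → Horizon T → ℝ) (g u : RealProcess T Ω) :
    RealProcess T Ω :=
  fun t ω => g t ω + kernelOp G u t ω

/-- The inventory `X^u_t = X₀ + ∫₀ᵗ u_s ds`. -/
noncomputable def inventory (X₀ : ℝ) (u : RealProcess T Ω) : RealProcess T Ω :=
  fun t ω => X₀ + ∫ s in Set.Iic t, u s ω

/-- The execution price `S^u = S + (γ/2) u + h(Z^u)`. -/
noncomputable def executionPrice (γ : ℝ) (h : ℝ → ℝ) (G : Horizon T → Horizon T → ℝ)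
    (g S u : RealProcess T Ω) : RealProcess T Ω :=
  fun t ω => S t ω + γ / 2 * u t ω + h (distortion G g u t ω)

end Kernels

section Stochastic

variable {T : ℝ} {Ω : Type*} [mΩ : MeasurableSpace Ω]

/-- The usual conditions: the filtration is right-continuous and every `σ`-algebra of it contains
all `P`-null sets (so that the probability space is complete too). -/
structure UsualConditions (F : Filtration (Horizon T) mΩ) (P : Measure Ω) : Prop where
  rightContinuous : F.IsRightContinuous
  complete : ∀ (t : Horizon T) (N : Set Ω), P N = 0 → MeasurableSet[F t] N

/-- The space `𝓛²`: progressively measurable processes that are square integrable with respect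
to `dt ⊗ P`. Elements are identified when they agree `dt ⊗ P`-almost everywhere. -/
def SqIntProgressive (F : Filtration (Horizon T) mΩ) (P : Measure Ω) : Set (RealProcess T Ω) :=
  {u | IsStronglyProgressive F u ∧ MemLp (Function.uncurry u) 2 (volume.prod P)}

/-- The inner product `⟨u, v⟩ = E[∫₀ᵀ u_t v_t dt]`. -/
noncomputable def innerL2 (P : Measure Ω) (u v : RealProcess T Ω) : ℝ :=
  ∫ ω, (∫ t, u t ω * v t ω) ∂P

/-- Equality `dt ⊗ P`-almost everywhere. -/
def EqAE (P : Measure Ω) (u v : RealProcess T Ω) : Prop :=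
  ∀ᵐ p ∂((volume : Measure (Horizon T)).prod P), u p.1 p.2 = v p.1 p.2

/-- `w ∈ 𝓛²` is a version of the family `Y` of random variables (each of which is only determined
up to a null set, like a conditional expectation) if `w_t = Y_t` almost surely for almost every
`t`. Any two versions agree `dt ⊗ P`-almost everywhere. -/
def IsVersion (F : Filtration (Horizon T) mΩ) (P : Measure Ω)
    (Y : Horizon T → Ω → ℝ) (w : RealProcess T Ω) : Prop :=
  w ∈ SqIntProgressive F P ∧ ∀ᵐ t : Horizon T, w t =ᵐ[P] Y t

open Classical in
/-- The element of `𝓛²` given by a family of random variables. -/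
noncomputable def version (F : Filtration (Horizon T) mΩ) (P : Measure Ω)
    (Y : Horizon T → Ω → ℝ) : RealProcess T Ω :=
  if H : ∃ w, IsVersion F P Y w then H.choose else 0

/-- The adjoint operator `(𝐆*u)_t = ∫_t^T G(s,t) E_t[u_s] ds`. For fixed `t`, the conditional
expectations `E_t[u_s]` are elements of `L¹(Ω, P)`, and the integral in `s` is the Bochner integral
in `L¹(Ω, P)`; thus no choice of representatives of `E_t[u_s]` enters. -/
noncomputable def adjointOp (F : Filtration (Horizon T) mΩ) (P : Measure Ω)
    [IsProbabilityMeasure P] (G : Horizon T → Horizon T → ℝ) (u : RealProcess T Ω) :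
    RealProcess T Ω :=
  version F P fun t => ⇑(∫ s in Set.Ici t, G s t • condExpL1 (F.le t) P (u s))

/-- The nonlinear operator `𝐀(u) = h(Z^u) + 𝐆*(h'(Z^u) u)`. -/
noncomputable def impactOp (F : Filtration (Horizon T) mΩ) (P : Measure Ω)
    [IsProbabilityMeasure P] (h : ℝ → ℝ) (G : Horizon T → Horizon T → ℝ)
    (g u : RealProcess T Ω) : RealProcess T Ω :=
  fun t ω => h (distortion G g u t ω)
    + adjointOp F P G (fun s ω' => deriv h (distortion G g u s ω') * u s ω') t ω

/-- Monotonicity of an operator on `𝓛²`. -/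
def IsMonotoneOp (F : Filtration (Horizon T) mΩ) (P : Measure Ω)
    (A : RealProcess T Ω → RealProcess T Ω) : Prop :=
  ∀ u ∈ SqIntProgressive F P, ∀ v ∈ SqIntProgressive F P, 0 ≤ innerL2 P (u - v) (A u - A v)

/-- The alpha-signal `α_t = E_t[S_T - S_t]`. -/
noncomputable def alphaSignal (hT : 0 < T) (F : Filtration (Horizon T) mΩ) (P : Measure Ω)
    (S : RealProcess T Ω) : RealProcess T Ω :=
  version F P fun t => P[fun ω => S (terminal hT) ω - S t ω | F t]

/-- The performance functional
`J(u) = E[-∫₀ᵀ S^u_t u_t dt + X^u_T S_T - (φ/2) ∫₀ᵀ (X^u_t)² dt - (ϱ/2) (X^u_T)²]`. -/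
noncomputable def performance (hT : 0 < T) (P : Measure Ω) (X₀ γ φ ϱ : ℝ) (h : ℝ → ℝ)
    (G : Horizon T → Horizon T → ℝ) (g S u : RealProcess T Ω) : ℝ :=
  ∫ ω, (-(∫ t, executionPrice γ h G g S u t ω * u t ω)
    + inventory X₀ u (terminal hT) ω * S (terminal hT) ω
    - φ / 2 * (∫ t, inventory X₀ u t ω ^ 2)
    - ϱ / 2 * inventory X₀ u (terminal hT) ω ^ 2) ∂P

/-- `u ∈ 𝓛²` is optimal for `J` if `J(u) = sup_{v ∈ 𝓛²} J(v)`. -/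
def IsOptimal (F : Filtration (Horizon T) mΩ) (P : Measure Ω) (J : RealProcess T Ω → ℝ)
    (u : RealProcess T Ω) : Prop :=
  u ∈ SqIntProgressive F P ∧ ∀ v ∈ SqIntProgressive F P, J v ≤ J u

/-- `u ∈ 𝓛²` solves the nonlinear stochastic Fredholm equation
`γ u + 𝐀(u) + 𝐇u + 𝐇*u = α - X₀ (φ (T - t) + ϱ)`, `dt ⊗ P`-almost everywhere. -/
def SolvesFredholm (hT : 0 < T) (F : Filtration (Horizon T) mΩ) (P : Measure Ω)
    [IsProbabilityMeasure P] (X₀ γ φ ϱ : ℝ) (h : ℝ → ℝ)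
    (G : Horizon T → Horizon T → ℝ) (g S u : RealProcess T Ω) : Prop :=
  u ∈ SqIntProgressive F P ∧
    EqAE P
      (fun t ω => γ * u t ω + impactOp F P h G g u t ω
        + kernelOp (inventoryKernel T φ ϱ) u t ω
        + adjointOp F P (inventoryKernel T φ ϱ) u t ω)
      (fun t ω => alphaSignal hT F P S t ω - X₀ * (φ * (T - (t : ℝ)) + ϱ))

end Stochastic

end OptimalExecution

/-! The Fredholm equation is the first order condition of a strongly concave problem on a Hilbert
space. Path by path, with `U_t = ∫₀ᵗ u`, one has `φ ∫ U² + ϱ U_T² = 2 ∫ (φ (T - t) + ϱ) U_t u_t dt`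
(`inventory_quadratic`). This turns both inventory penalties into a pairing with `𝐇u`, and `J(u)`
becomes a constant plus `⟨u, S_T - S - X₀ (φ (T - t) + ϱ) - (γ/2) u - h(Z^u) - 𝐇u⟩`
(`performance_eq`). Differentiation under the integral and the dualities of `𝐆, 𝐆*` and of `𝐇, 𝐇*`
give the derivative of `J` at `u` in direction `d` as `-⟨r(u), d⟩`, with `r(u)` the `residual` of
the equation (`hasDerivAt_performance`).

Monotonicity of `𝐀` and positivity of `𝐇 + 𝐇*` yield `⟨r(v) - r(u), v - u⟩ ≥ γ ‖v - u‖²`. Integrated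
along the segment from `u` to `v`, this is `J(v) ≤ J(u) - ⟨r(u), v - u⟩ - (γ/2) ‖v - u‖²`
(`performance_le`), from which the rest follows. Maximising sequences are Cauchy and their limits
are optimal. At an optimum the derivative in direction `r(u)`, which is `-‖r(u)‖²`, vanishes. If
`r(u) = 0`, a competitor that does at least as well as `u` must equal `u`.

The probabilistic work is to show that `𝐆*u` and `α` are elements of `𝓛²` at all. Here `𝓛²` is the
`L²` space of the progressive `σ`-algebra, and the conditional expectation of `f` given that
`σ`-algebra has the sections `E_t[f_t]` for almost every `t` (`condExp_progressive_section`). For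
indicators of rectangles this amounts to a progressive version of a closed martingale, obtained as a
limit along dyadic times; `L¹` approximation does the rest. Hence `𝐆*` is transposition of the
kernel followed by orthogonal projection onto `𝓛²`, and is dual to `𝐆` there (`adjointOp_spec`). -/

namespace OptimalExecution

open Filter Topology
open scoped ENNReal

/-! ### Approximation by rectangles, and sections in `L¹` -/

section ProductInduction

variable {α β : Type*} [MeasurableSpace α] [MeasurableSpace β]

/-- If the `L¹` distances to a function of the product are summable, then almost every section
converges in `L¹`. -/
lemma ae_tendsto_eLpNorm_section {μ : Measure α} {ν : Measure β} [IsFiniteMeasure μ]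
    [IsFiniteMeasure ν] {d : ℕ → α × β → ℝ} (hd : ∀ n, Integrable (d n) (μ.prod ν))
    (hsum : ∑' n, eLpNorm (d n) 1 (μ.prod ν) ≠ ∞) :
    ∀ᵐ a ∂μ, Tendsto (fun n => eLpNorm (fun b => d n (a, b)) 1 ν) atTop (𝓝 0) := by
  have hm : ∀ n, AEMeasurable (fun a => ∫⁻ b, ‖d n (a, b)‖ₑ ∂ν) μ := fun n =>
    (hd n).aestronglyMeasurable.enorm.lintegral_prod_right'
  have h1 : ∫⁻ a, ∑' n, ∫⁻ b, ‖d n (a, b)‖ₑ ∂ν ∂μ ≠ ∞ := by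
    rw [lintegral_tsum hm]
    convert hsum using 3 with n
    rw [eLpNorm_one_eq_lintegral_enorm, lintegral_prod _ (hd n).aestronglyMeasurable.enorm]
  filter_upwards [ae_lt_top' (AEMeasurable.tsum hm) h1] with a ha
  simp_rw [eLpNorm_one_eq_lintegral_enorm]
  exact ENNReal.tendsto_atTop_zero_of_tsum_ne_top ha.ne

/-- Induction principle for integrable functions on a product of two finite measure spaces, with
indicators of measurable rectangles as building blocks. -/
lemma integrable_prod_induction {μ : Measure α} {ν : Measure β} [IsFiniteMeasure μ]
    [IsFiniteMeasure ν] (Q : (α × β → ℝ) → Prop)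
    (rect : ∀ A B, MeasurableSet A → MeasurableSet B → Q ((A ×ˢ B).indicator fun _ => 1))
    (smul : ∀ (c : ℝ) f, Integrable f (μ.prod ν) → Q f → Q (c • f))
    (add : ∀ f g, Integrable f (μ.prod ν) → Integrable g (μ.prod ν) → Q f → Q g → Q (f + g))
    (lim : ∀ (f : ℕ → α × β → ℝ) g, (∀ n, Integrable (f n) (μ.prod ν)) →
      Integrable g (μ.prod ν) → (∀ n, Q (f n)) →
      ∑' n, eLpNorm (f n - g) 1 (μ.prod ν) ≠ ∞ → Q g)
    {f : α × β → ℝ} (hf : Integrable f (μ.prod ν)) : Q f := by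
  -- Approximation to every precision suffices: errors can be chosen below a summable sequence.
  -- Summability is what makes almost every section converge without passing to a subsequence.
  have close : ∀ g, Integrable g (μ.prod ν) →
      (∀ ε : ℝ≥0∞, 0 < ε → ∃ f, Integrable f (μ.prod ν) ∧ Q f ∧
        eLpNorm (f - g) 1 (μ.prod ν) < ε) → Q g := by
    intro g hg h
    obtain ⟨ε, hε, hsum⟩ := ENNReal.exists_pos_sum_of_countable (ε := 1) one_ne_zero ℕ
    choose f hf hQ hlt using fun n => h (ε n) (by exact_mod_cast hε n)
    refine lim f g hf hg hQ (ne_top_of_le_ne_top (hsum.trans_le le_top).ne ?_)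
    exact ENNReal.tsum_le_tsum fun n => (hlt n).le
  have aecongr : ∀ f g, f =ᵐ[μ.prod ν] g → Integrable f (μ.prod ν) → Q f → Q g := by
    intro f g hfg hf hQ
    refine close g (hf.congr hfg) fun ε hε => ⟨f, hf, hQ, ?_⟩
    rw [(eLpNorm_congr_ae (hfg.sub (ae_eq_refl g)) : _ = eLpNorm (g - g) 1 _)]
    simpa using hε
  have hint : ∀ s : Set (α × β), MeasurableSet s →
      Integrable (s.indicator fun _ => (1 : ℝ)) (μ.prod ν) := fun s hs =>
    (integrable_const _).indicator hs
  -- Rectangles form a π-system generating the product `σ`-algebra. Complements are handled by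
  -- linearity, countable disjoint unions by `close` and continuity from above of the finite
  -- measure.
  have ind : ∀ s : Set (α × β), MeasurableSet s → Q (s.indicator fun _ => 1) := by
    refine MeasurableSpace.induction_on_inter generateFrom_prod.symm isPiSystem_prod ?_ ?_ ?_ ?_
    · simpa using rect ∅ ∅ .empty .empty
    · rintro _ ⟨A, hA, B, hB, rfl⟩
      exact rect A B hA hB
    · intro t ht hQ
      have h1 := add _ _ (hint _ .univ) ((hint t ht).smul (-1 : ℝ))
        (by simpa using rect Set.univ Set.univ .univ .univ) (smul (-1) _ (hint t ht) hQ)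
      convert h1 using 1
      ext p
      by_cases hp : p ∈ t <;> simp [hp]
    · intro s hdis hs hQ
      have hfin : ∀ n : ℕ, MeasurableSet (⋃ i ∈ Finset.range n, s i) := fun n =>
        Finset.measurableSet_biUnion _ fun i _ => hs i
      have hQn : ∀ n : ℕ, Q ((⋃ i ∈ Finset.range n, s i).indicator fun _ => 1) := by
        intro n
        induction n with
        | zero => simpa using rect ∅ ∅ .empty .empty
        | succ n ih =>
          have h1 := add _ _ (hint _ (hfin n)) (hint _ (hs n)) ih (hQ n)
          have hd : Disjoint (⋃ i ∈ Finset.range n, s i) (s n) := by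
            simp only [Set.disjoint_iUnion_left]
            exact fun i hi => hdis (Finset.mem_range.1 hi).ne
          convert h1 using 1
          rw [Finset.range_add_one, Finset.set_biUnion_insert, Set.union_comm,
            Set.indicator_union_of_disjoint hd]
          rfl
      refine close _ (hint _ (.iUnion hs)) fun ε hε => ?_
      have htend : Tendsto (fun n : ℕ => (μ.prod ν) ((⋃ i, s i) \ ⋃ i ∈ Finset.range n, s i))
          atTop (𝓝 0) := by
        have hInter : ⋂ n : ℕ, ((⋃ i, s i) \ ⋃ i ∈ Finset.range n, s i) = ∅ := by
          ext p
          simp only [Set.mem_iInter, Set.mem_sdiff, Set.mem_iUnion, Finset.mem_range,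
            Set.mem_empty_iff_false, iff_false, not_forall]
          by_contra! hp
          obtain ⟨⟨i, hi⟩, -⟩ := hp 0
          exact (hp (i + 1)).2 i (by omega) hi
        have := tendsto_measure_iInter_atTop (μ := μ.prod ν)
          (s := fun n : ℕ => (⋃ i, s i) \ ⋃ i ∈ Finset.range n, s i)
          (fun n => ((MeasurableSet.iUnion hs).diff (hfin n)).nullMeasurableSet)
          (fun m n hmn => Set.sdiff_subset_sdiff_right
            (Set.biUnion_subset_biUnion_left (by simpa using hmn)))
          ⟨0, measure_ne_top _ _⟩
        rwa [hInter, measure_empty] at this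
      obtain ⟨n, hn⟩ := (htend.eventually (gt_mem_nhds hε)).exists
      refine ⟨_, hint _ (hfin n), hQn n, ?_⟩
      rw [eLpNorm_one_eq_lintegral_enorm]
      refine lt_of_le_of_lt ?_ hn
      rw [← lintegral_indicator_one ((MeasurableSet.iUnion hs).diff (hfin n))]
      refine lintegral_mono fun p => ?_
      by_cases h1 : p ∈ ⋃ i ∈ Finset.range n, s i
      · have h2 : p ∈ ⋃ i, s i := by
          simp only [Set.mem_iUnion] at h1 ⊢
          exact ⟨h1.choose, h1.choose_spec.choose_spec⟩
        simp only [Pi.sub_apply, Set.indicator_of_mem h1, Set.indicator_of_mem h2]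
        simp
      · by_cases h2 : p ∈ ⋃ i, s i
        · have h3 : p ∈ (⋃ i, s i) \ ⋃ i ∈ Finset.range n, s i := ⟨h2, h1⟩
          simp only [Pi.sub_apply, Set.indicator_of_mem h2, Set.indicator_of_notMem h1,
            Set.indicator_of_mem h3]
          simp
        · simp only [Pi.sub_apply, Set.indicator_of_notMem h2, Set.indicator_of_notMem h1]
          simp
  refine Integrable.induction (μ := μ.prod ν) Q ?_ ?_ ?_ aecongr hf
  · intro c s hs _
    convert smul c _ (hint s hs) (ind s hs) using 1
    ext p
    by_cases hp : p ∈ s <;> simp [hp]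
  · exact fun f g _ hf hg hQf hQg => add f g hf hg hQf hQg
  · refine isClosed_of_closure_subset fun g hg => ?_
    refine close g (L1.integrable_coeFn g) fun ε hε => ?_
    obtain ⟨f, hf, hfg⟩ := EMetric.mem_closure_iff.1 hg ε hε
    refine ⟨f, L1.integrable_coeFn f, hf, ?_⟩
    rwa [edist_comm, Lp.edist_def] at hfg

/-- The sections of an integrable function on a product depend measurably on the point, as
elements of `L¹`. -/
lemma exists_aestronglyMeasurable_section {μ : Measure α} {ν : Measure β} [IsFiniteMeasure μ]
    [IsFiniteMeasure ν] {f : α × β → ℝ} (hf : Integrable f (μ.prod ν)) :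
    ∃ Φ : α → Lp ℝ 1 ν, AEStronglyMeasurable Φ μ ∧ ∀ᵐ a ∂μ, Φ a =ᵐ[ν] fun b => f (a, b) := by
  refine integrable_prod_induction (μ := μ) (ν := ν)
    (fun f => ∃ Φ : α → Lp ℝ 1 ν, AEStronglyMeasurable Φ μ ∧
      ∀ᵐ a ∂μ, Φ a =ᵐ[ν] fun b => f (a, b)) ?_ ?_ ?_ ?_ hf
  · intro A B hA hB
    refine ⟨A.indicator fun _ => indicatorConstLp 1 hB (measure_ne_top ν B) 1,
      (stronglyMeasurable_const.indicator hA).aestronglyMeasurable, .of_forall fun a => ?_⟩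
    by_cases ha : a ∈ A
    · rw [Set.indicator_of_mem ha]
      refine indicatorConstLp_coeFn.trans (.of_eq ?_)
      ext b
      by_cases hb : b ∈ B <;> simp [ha, hb]
    · rw [Set.indicator_of_notMem ha]
      refine (Lp.coeFn_zero ℝ 1 ν).trans (.of_eq ?_)
      ext b
      simp [ha]
  · rintro c f - ⟨Φ, hΦ, h⟩
    refine ⟨c • Φ, hΦ.const_smul c, h.mono fun a ha => ?_⟩
    filter_upwards [Lp.coeFn_smul c (Φ a), ha] with b h1 h2
    simp only [Pi.smul_apply] at h1 ⊢
    rw [h1, h2]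
  · rintro f g - - ⟨Φ, hΦ, h⟩ ⟨Ψ, hΨ, h'⟩
    refine ⟨Φ + Ψ, hΦ.add hΨ, (h.and h').mono fun a ha => ?_⟩
    filter_upwards [Lp.coeFn_add (Φ a) (Ψ a), ha.1, ha.2] with b h1 h2 h3
    simp only [Pi.add_apply] at h1 ⊢
    rw [h1, h2, h3]
  · intro f g hf hg h hsum
    choose Φ hΦ h using h
    classical
    let Ψ : α → Lp ℝ 1 ν := fun a =>
      if h : Integrable (fun b => g (a, b)) ν then h.toL1 _ else 0
    have hΨ : ∀ᵐ a ∂μ, Ψ a =ᵐ[ν] fun b => g (a, b) := by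
      filter_upwards [hg.prod_right_ae] with a ha
      simp only [Ψ, dif_pos ha]
      exact ha.coeFn_toL1
    refine ⟨Ψ, ?_, hΨ⟩
    refine aestronglyMeasurable_of_tendsto_ae atTop hΦ ?_
    filter_upwards [hΨ, ae_all_iff.2 h,
      ae_tendsto_eLpNorm_section (fun n => (hf n).sub hg) hsum] with a h1 h2 h3
    rw [tendsto_iff_edist_tendsto_0]
    refine h3.congr fun n => ?_
    rw [Lp.edist_def]
    exact eLpNorm_congr_ae ((h2 n).sub h1).symm

end ProductInduction

/-! ### Measurability with explicit `σ`-algebras -/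

section Auxiliary

lemma stronglyMeasurable_of_preimage {α : Type*} {m : MeasurableSpace α} {f : α → ℝ}
    (h : ∀ B, MeasurableSet B → MeasurableSet[m] (f ⁻¹' B)) : StronglyMeasurable[m] f :=
  Measurable.stronglyMeasurable fun B hB => h B hB

lemma measurableSet_preimage_of_stronglyMeasurable {α : Type*} {m : MeasurableSpace α}
    {f : α → ℝ} (h : StronglyMeasurable[m] f) {B : Set ℝ} (hB : MeasurableSet B) :
    MeasurableSet[m] (f ⁻¹' B) :=
  h.measurable hB

lemma stronglyMeasurable_limsup {α : Type*} {m : MeasurableSpace α} {f : ℕ → α → ℝ}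
    (h : ∀ n, StronglyMeasurable[m] (f n)) :
    StronglyMeasurable[m] fun a => limsup (fun n => f n a) atTop :=
  (Measurable.limsup fun n => (h n).measurable).stronglyMeasurable

lemma measurable_prodMk_of_le {α β : Type*} {mα : MeasurableSpace α} {m m' : MeasurableSpace β}
    (h : m' ≤ m) {γ : Type*} {mγ : MeasurableSpace γ} {f : α → γ} (hf : Measurable f) :
    @Measurable _ _ (mα.prod m) (mγ.prod m') fun p : α × β => (f p.1, p.2) :=
  Measurable.prodMk (hf.comp measurable_fst) (measurable_snd.mono le_rfl h)

lemma measurable_prodMk_const {α β : Type*} {mα : MeasurableSpace α} {m : MeasurableSpace β}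
    (a : α) : @Measurable _ _ m (mα.prod m) fun b : β => (a, b) :=
  measurable_prodMk_left

lemma measurableSet_prod_of {α β : Type*} {mα : MeasurableSpace α} {m : MeasurableSpace β}
    {A : Set α} {B : Set β} (hA : MeasurableSet A) (hB : MeasurableSet B) :
    MeasurableSet[mα.prod m] (A ×ˢ B) :=
  hA.prod hB

end Auxiliary

/-! ### The progressive `σ`-algebra and dyadic approximation of time -/

section Progressive

variable {T : ℝ} {Ω : Type*} [mΩ : MeasurableSpace Ω]

/-- The progressive `σ`-algebra on `[0, T] × Ω`. -/
@[reducible] def progressiveSigma (F : Filtration (Horizon T) mΩ) : MeasurableSpace (Horizon T × Ω) :=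
  ⨅ t : Horizon T, (Subtype.instMeasurableSpace.prod (F t)).map
    fun p : Set.Iic t × Ω => ((p.1 : Horizon T), p.2)

lemma measurableSet_progressiveSigma {F : Filtration (Horizon T) mΩ} {A : Set (Horizon T × Ω)} :
    MeasurableSet[progressiveSigma F] A ↔ ∀ t : Horizon T,
      MeasurableSet[Subtype.instMeasurableSpace.prod (F t)]
        ((fun p : Set.Iic t × Ω => ((p.1 : Horizon T), p.2)) ⁻¹' A) := by
  rw [progressiveSigma, MeasurableSpace.measurableSet_iInf]
  rfl

lemma isStronglyProgressive_iff {F : Filtration (Horizon T) mΩ} {u : RealProcess T Ω} :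
    IsStronglyProgressive F u ↔ StronglyMeasurable[progressiveSigma F] (Function.uncurry u) := by
  constructor
  · intro h
    refine stronglyMeasurable_of_preimage fun B hB => ?_
    exact measurableSet_progressiveSigma.2 fun t =>
      measurableSet_preimage_of_stronglyMeasurable (h t) hB
  · intro h t
    refine stronglyMeasurable_of_preimage fun B hB => ?_
    exact measurableSet_progressiveSigma.1
      (measurableSet_preimage_of_stronglyMeasurable h hB) t

/-- The restriction to times up to `T` is no restriction, and `F T` lies in the ambient `σ`-algebra.
-/
lemma progressiveSigma_le (hT : 0 < T) (F : Filtration (Horizon T) mΩ) :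
    progressiveSigma F ≤ Prod.instMeasurableSpace := by
  intro A hA
  have h := measurableSet_progressiveSigma.1 hA (terminal hT)
  have hm := measurable_prodMk_of_le (mα := Subtype.instMeasurableSpace)
    (mγ := Subtype.instMeasurableSpace) (F.le (terminal hT))
    (f := fun t : Horizon T => (⟨t, t.2.2⟩ : Set.Iic (terminal hT))) (measurable_id (α := Horizon T)).subtype_mk
  exact hm h

lemma measurableSet_section {F : Filtration (Horizon T) mΩ} {A : Set (Horizon T × Ω)}
    (hA : MeasurableSet[progressiveSigma F] A) (t : Horizon T) :
    MeasurableSet[F t] (Prod.mk t ⁻¹' A) := by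
  have h := measurableSet_progressiveSigma.1 hA t
  have hm := measurable_prodMk_const (mα := Subtype.instMeasurableSpace) (m := F t)
    (⟨t, Set.self_mem_Iic⟩ : Set.Iic t)
  exact hm h

/-- Up to time `t`, either `B` has no point and the set is empty, or some `s ∈ B` with `s ≤ t` puts
`A` in `F s ≤ F t`. -/
lemma measurableSet_prod_progressiveSigma {F : Filtration (Horizon T) mΩ} {B : Set (Horizon T)}
    {A : Set Ω} (hB : MeasurableSet B) (hA : ∀ t ∈ B, MeasurableSet[F t] A) :
    MeasurableSet[progressiveSigma F] (B ×ˢ A) := by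
  refine measurableSet_progressiveSigma.2 fun t => ?_
  rcases (B ∩ Set.Iic t).eq_empty_or_nonempty with h | ⟨s, hs⟩
  · convert @MeasurableSet.empty _ (Subtype.instMeasurableSpace.prod (F t))
    ext p
    simp only [Set.mem_preimage, Set.mem_prod, Set.mem_empty_iff_false, iff_false, not_and]
    intro hp
    exact absurd (show (p.1 : Horizon T) ∈ B ∩ Set.Iic t from ⟨hp, p.1.2⟩) (by simp [h])
  · exact measurableSet_prod_of (measurable_subtype_coe hB)
      (F.mono hs.2 _ (hA s hs.1))

/-- The dyadic left approximation of a point of `[0, T]`. -/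
noncomputable def dyadic (n : ℕ) (t : Horizon T) : Horizon T :=
  ⟨⌊2 ^ n * (t : ℝ)⌋₊ / 2 ^ n, by
    constructor
    · positivity
    · rw [div_le_iff₀ (by positivity)]
      calc ((⌊2 ^ n * (t : ℝ)⌋₊ : ℕ) : ℝ) ≤ 2 ^ n * t :=
            Nat.floor_le (mul_nonneg (by positivity) t.2.1)
        _ ≤ T * 2 ^ n := by rw [mul_comm]; gcongr; exact t.2.2⟩

lemma dyadic_le (n : ℕ) (t : Horizon T) : dyadic n t ≤ t := by
  change (⌊2 ^ n * (t : ℝ)⌋₊ : ℝ) / 2 ^ n ≤ t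
  rw [div_le_iff₀ (by positivity), mul_comm (t : ℝ)]
  exact Nat.floor_le (mul_nonneg (by positivity) t.2.1)

lemma dyadic_mono (t : Horizon T) : Monotone fun n => dyadic n t := by
  refine monotone_nat_of_le_succ fun n => ?_
  change (⌊2 ^ n * (t : ℝ)⌋₊ : ℝ) / 2 ^ n ≤ (⌊2 ^ (n + 1) * (t : ℝ)⌋₊ : ℝ) / 2 ^ (n + 1)
  rw [div_le_div_iff₀ (by positivity) (by positivity)]
  have h : 2 * ⌊2 ^ n * (t : ℝ)⌋₊ ≤ ⌊2 ^ (n + 1) * (t : ℝ)⌋₊ := by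
    refine Nat.le_floor ?_
    push_cast
    have := Nat.floor_le (mul_nonneg (by positivity : (0 : ℝ) ≤ 2 ^ n) t.2.1)
    rw [pow_succ]
    linarith
  have h' : (2 : ℝ) * ⌊2 ^ n * (t : ℝ)⌋₊ ≤ ⌊2 ^ (n + 1) * (t : ℝ)⌋₊ := by exact_mod_cast h
  calc (⌊2 ^ n * (t : ℝ)⌋₊ : ℝ) * 2 ^ (n + 1) = 2 * ⌊2 ^ n * (t : ℝ)⌋₊ * 2 ^ n := by ring
    _ ≤ _ := by gcongr

lemma tendsto_dyadic (t : Horizon T) : Tendsto (fun n => dyadic n t) atTop (𝓝 t) := by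
  rw [tendsto_subtype_rng]
  have h0 : Tendsto (fun n : ℕ => (t : ℝ) - (1 / 2) ^ n) atTop (𝓝 t) := by
    simpa using tendsto_const_nhds.sub
      (tendsto_pow_atTop_nhds_zero_of_lt_one (r := (1 / 2 : ℝ)) (by norm_num) (by norm_num))
  refine tendsto_of_tendsto_of_tendsto_of_le_of_le h0 tendsto_const_nhds (fun n => ?_)
    fun n => dyadic_le n t
  change (t : ℝ) - (1 / 2) ^ n ≤ (⌊2 ^ n * (t : ℝ)⌋₊ : ℝ) / 2 ^ n
  rw [le_div_iff₀ (by positivity), sub_mul, ← mul_pow]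
  have := (Nat.lt_floor_add_one (2 ^ n * (t : ℝ))).le
  norm_num
  linarith

/-- A process that is constant on dyadic intervals, with a value known at their left ends, is
progressive. -/
lemma stronglyMeasurable_dyadic {F : Filtration (Horizon T) mΩ} {M : Horizon T → Ω → ℝ}
    (hM : ∀ s, StronglyMeasurable[F s] (M s)) (n : ℕ) :
    StronglyMeasurable[progressiveSigma F]
      fun p : Horizon T × Ω => M (dyadic n p.1) p.2 := by
  refine stronglyMeasurable_of_preimage fun B hB => ?_
  have hmeas : Measurable fun t : Horizon T => ⌊2 ^ n * (t : ℝ)⌋₊ :=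
    Nat.measurable_floor.comp (measurable_subtype_coe.const_mul _)
  -- The time `k / 2 ^ n` may lie outside `[0, T]`; the existential in the second factor makes it
  -- empty in that case.
  have h : (fun p : Horizon T × Ω => M (dyadic n p.1) p.2) ⁻¹' B =
      ⋃ k : ℕ, ({t : Horizon T | ⌊2 ^ n * (t : ℝ)⌋₊ = k} ×ˢ
        {ω | ∃ s : Horizon T, (s : ℝ) = k / 2 ^ n ∧ M s ω ∈ B}) := by
    ext ⟨t, ω⟩
    simp only [Set.mem_preimage, Set.mem_iUnion, Set.mem_prod, Set.mem_ofPred_eq]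
    constructor
    · exact fun hp => ⟨_, rfl, dyadic n t, rfl, hp⟩
    · rintro ⟨k, hk, s, hs, hsB⟩
      have : dyadic n t = s := Subtype.ext (by rw [hs, ← hk]; rfl)
      rwa [this]
  rw [h]
  refine @MeasurableSet.iUnion _ _ (progressiveSigma F) _ _ fun k => ?_
  refine measurableSet_prod_progressiveSigma (hmeas (measurableSet_singleton k)) ?_
  rintro t ht
  have h2 : {ω | ∃ s : Horizon T, (s : ℝ) = k / 2 ^ n ∧ M s ω ∈ B} = M (dyadic n t) ⁻¹' B := by
    ext ω
    simp only [Set.mem_ofPred_eq, Set.mem_preimage]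
    have hd : (dyadic n t : ℝ) = k / 2 ^ n := by rw [← ht]; rfl
    constructor
    · rintro ⟨s, hs, hsB⟩
      have : dyadic n t = s := Subtype.ext (by rw [hs, hd])
      rwa [this]
    · exact fun hp => ⟨_, hd, hp⟩
  rw [h2]
  exact F.mono (dyadic_le n t) _
    (measurableSet_preimage_of_stronglyMeasurable (hM (dyadic n t)) hB)

/-- This makes countable sets of times negligible, and also the diagonal in double time integrals.
-/
instance : NullSingletonClass (volume : Measure (Horizon T)) where
  measure_singleton t := by
    rw [Measure.Subtype.volume_def, comap_subtype_coe_apply measurableSet_Icc]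
    simp

end Progressive

/-! ### Progressive versions of closed martingales -/

section Martingale

variable {T : ℝ} {Ω : Type*} [mΩ : MeasurableSpace Ω] {P : Measure Ω} [IsProbabilityMeasure P]

/-- Pythagoras for conditional expectations of a square integrable random variable. -/
lemma integral_sq_condExp_sub {m₁ m₂ : MeasurableSpace Ω} (h12 : m₁ ≤ m₂) (h2 : m₂ ≤ mΩ)
    {ξ : Ω → ℝ} (hξ : MemLp ξ 2 P) :
    ∫ ω, (P[ξ | m₁] ω - P[ξ | m₂] ω) ^ 2 ∂P
      = ∫ ω, P[ξ | m₂] ω ^ 2 ∂P - ∫ ω, P[ξ | m₁] ω ^ 2 ∂P := by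
  have hL1 : MemLp (P[ξ | m₁]) 2 P := hξ.condExp one_le_two
  have hL2 : MemLp (P[ξ | m₂]) 2 P := hξ.condExp one_le_two
  -- Pull the `m₁`-measurable factor out and apply the tower property.
  have hcross : ∫ ω, P[ξ | m₁] ω * P[ξ | m₂] ω ∂P = ∫ ω, P[ξ | m₁] ω ^ 2 ∂P := by
    have hint : Integrable (P[ξ | m₁] * P[ξ | m₂]) P := hL1.integrable_mul hL2
    have h := condExp_mul_of_stronglyMeasurable_left (m := m₁) (μ := P)
      stronglyMeasurable_condExp hint (hL2.integrable one_le_two)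
    change ∫ ω, (P[ξ | m₁] * P[ξ | m₂]) ω ∂P = _
    rw [← integral_condExp (h12.trans h2)]
    refine integral_congr_ae ?_
    filter_upwards [h, condExp_condExp_of_le (f := ξ) h12 h2] with ω h1 h2
    rw [h1, Pi.mul_apply, h2, sq]
  have : ∀ ω, (P[ξ | m₁] ω - P[ξ | m₂] ω) ^ 2
      = P[ξ | m₁] ω ^ 2 + P[ξ | m₂] ω ^ 2 - 2 * (P[ξ | m₁] ω * P[ξ | m₂] ω) := fun ω => by ring
  simp_rw [this]
  rw [integral_sub (f := fun ω => P[ξ | m₁] ω ^ 2 + P[ξ | m₂] ω ^ 2)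
    (g := fun ω => 2 * (P[ξ | m₁] ω * P[ξ | m₂] ω)) (hL1.integrable_sq.add hL2.integrable_sq)
    ((hL1.integrable_mul hL2).const_mul 2), integral_add hL1.integrable_sq hL2.integrable_sq,
    integral_const_mul, hcross]
  ring

/-- The martingale closed by a square integrable random variable has a progressive version. -/
lemma exists_progressive_martingale (F : Filtration (Horizon T) mΩ) {ξ : Ω → ℝ}
    (hξ : MemLp ξ 2 P) :
    ∃ w : Horizon T × Ω → ℝ, StronglyMeasurable[progressiveSigma F] w ∧
      ∀ᵐ t : Horizon T, (fun ω => w (t, ω)) =ᵐ[P] P[ξ | F t] := by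
  set M : ℕ → Horizon T × Ω → ℝ := fun n p => P[ξ | F (dyadic n p.1)] p.2 with hMdef
  have hM : ∀ n, StronglyMeasurable[progressiveSigma F] (M n) := fun n =>
    stronglyMeasurable_dyadic (M := fun s => P[ξ | F s]) (fun s => stronglyMeasurable_condExp) n
  refine ⟨fun p => limsup (fun n => M n p) atTop, ?_, ?_⟩
  · exact stronglyMeasurable_limsup hM
  -- The second moment of the martingale is monotone in time, hence continuous off a countable set.
  -- At a continuity point `t`, Pythagoras bounds the squared `L²` distance of the dyadic
  -- approximations to `E_t[ξ]` by an increment of `ψ` that tends to zero.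
  set ψ : Horizon T → ℝ := fun t => ∫ ω, P[ξ | F t] ω ^ 2 ∂P with hψ
  have hmono : Monotone ψ := by
    intro s t hst
    have h := integral_sq_condExp_sub (P := P) (F.mono hst) (F.le t) hξ
    have h0 : 0 ≤ ∫ ω, (P[ξ | F s] ω - P[ξ | F t] ω) ^ 2 ∂P :=
      integral_nonneg fun ω => sq_nonneg _
    rw [h] at h0
    exact sub_nonneg.1 h0
  have hcont : ∀ᵐ t : Horizon T, ContinuousAt ψ t := by
    have := hmono.countable_not_continuousAt.measure_zero volume
    exact measure_eq_zero_iff_ae_notMem.1 this |>.mono fun t ht => not_not.1 ht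
  filter_upwards [hcont] with t ht
  let ℱ : Filtration ℕ mΩ := ⟨fun n => F (dyadic n t), fun i j hij => F.mono (dyadic_mono t hij),
    fun n => F.le _⟩
  have hlevy : ∀ᵐ ω ∂P, Tendsto (fun n => M n (t, ω)) atTop (𝓝 ((P[ξ | ⨆ n, ℱ n]) ω)) :=
    tendsto_ae_condExp (ℱ := ℱ) ξ
  have hmeas : ∀ n, AEStronglyMeasurable (fun ω => M n (t, ω)) P := fun n =>
    (stronglyMeasurable_condExp.mono (F.le (dyadic n t))).aestronglyMeasurable
  have hL2 : Tendsto (fun n => eLpNorm ((fun ω => M n (t, ω)) - P[ξ | F t]) 2 P) atTop (𝓝 0) := by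
    have h1 : Tendsto (fun n => ψ t - ψ (dyadic n t)) atTop (𝓝 0) := by
      simpa using (tendsto_const_nhds (x := ψ t)).sub (ht.tendsto.comp (tendsto_dyadic t))
    have h2 : ∀ n, eLpNorm ((fun ω => M n (t, ω)) - P[ξ | F t]) 2 P
        = ENNReal.ofReal (ψ t - ψ (dyadic n t)) ^ (1 / 2 : ℝ) := by
      intro n
      rw [← integral_sq_condExp_sub (F.mono (dyadic_le n t)) (F.le t) hξ,
        ofReal_integral_eq_lintegral_ofReal
          (f := fun ω => (P[ξ | F (dyadic n t)] ω - P[ξ | F t] ω) ^ 2) (((hξ.condExp one_le_two).sub (hξ.condExp one_le_two)).integrable_sq)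
          (.of_forall fun ω => sq_nonneg _),
        eLpNorm_eq_lintegral_rpow_enorm_toReal (by simp) (by simp)]
      congr 1
      refine lintegral_congr fun ω => ?_
      simp only [ENNReal.toReal_ofNat, Pi.sub_apply]
      rw [← sq_abs, ENNReal.ofReal_pow (abs_nonneg _), ← Real.norm_eq_abs, ofReal_norm]
      norm_cast
    simp_rw [h2]
    have h3 := (ENNReal.continuous_ofReal.tendsto 0).comp h1
    have h4 := (ENNReal.continuous_rpow_const (y := 1 / 2)).tendsto (ENNReal.ofReal 0) |>.comp h3
    simpa [Function.comp_def] using h4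
  -- Lévy's upward theorem gives almost sure convergence, but to the conditional expectation given
  -- the union of the `F (dyadic n t)`. Uniqueness of limits in measure identifies it with the `L²`
  -- limit `E_t[ξ]`.
  have hm1 := tendstoInMeasure_of_tendsto_eLpNorm (by simp) hmeas
    integrable_condExp.aestronglyMeasurable hL2
  have hm2 := tendstoInMeasure_of_tendsto_ae hmeas hlevy
  filter_upwards [tendstoInMeasure_ae_unique hm1 hm2, hlevy] with ω h1 h2
  rw [h1]
  exact h2.limsup_eq

end Martingale

/-! ### Sections of progressive conditional expectations -/

section ConditionalSections

variable {T : ℝ} {Ω : Type*} [mΩ : MeasurableSpace Ω] {P : Measure Ω} [IsProbabilityMeasure P]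

/-- The measure `dt ⊗ P` on `[0, T] × Ω`. -/
noncomputable abbrev timeProd (T : ℝ) {Ω : Type*} [MeasurableSpace Ω] (P : Measure Ω) :
    Measure (Horizon T × Ω) :=
  (volume : Measure (Horizon T)).prod P

/-- A progressive process whose sections are the conditional expectations of the sections of `f`
is the conditional expectation of `f` given the progressive `σ`-algebra. -/
lemma ae_eq_condExp_progressive (hT : 0 < T) {F : Filtration (Horizon T) mΩ}
    {f w : Horizon T × Ω → ℝ} (hf : Integrable f (timeProd T P))
    (hw : StronglyMeasurable[progressiveSigma F] w)
    (h : ∀ᵐ t : Horizon T, (fun ω => w (t, ω)) =ᵐ[P] P[fun ω => f (t, ω) | F t]) :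
    w =ᵐ[timeProd T P] (timeProd T P)[f | progressiveSigma F] := by
  have hle := progressiveSigma_le hT F
  have hwm : AEStronglyMeasurable w (timeProd T P) := (hw.mono hle).aestronglyMeasurable
  have hwint : Integrable w (timeProd T P) := by
    refine ⟨hwm, ?_⟩
    rw [HasFiniteIntegral, lintegral_prod _ hwm.enorm]
    refine lt_of_le_of_lt (lintegral_mono_ae ?_)
      ((lintegral_prod _ hf.aestronglyMeasurable.enorm).symm.trans_lt hf.2)
    filter_upwards [h] with t ht
    have h1 := eLpNorm_congr_ae (p := 1) ht
    rw [eLpNorm_one_eq_lintegral_enorm] at h1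
    rw [h1, ← eLpNorm_one_eq_lintegral_enorm]
    exact eLpNorm_condExp_le_eLpNorm _ le_rfl
  refine ae_eq_condExp_of_forall_setIntegral_eq hle hf (fun _ _ _ => hwint.integrableOn) ?_
    hw.aestronglyMeasurable
  intro D hD _
  rw [← integral_indicator (hle _ hD), ← integral_indicator (hle _ hD),
    integral_prod _ (hwint.indicator (hle _ hD)), integral_prod _ (hf.indicator (hle _ hD))]
  refine integral_congr_ae ?_
  filter_upwards [h, hf.prod_right_ae] with t ht hft
  -- Sections of a progressive set at time `t` lie in `F t`, so the defining property of `E_t`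
  -- applies slice by slice under Fubini.
  have hDt := measurableSet_section hD t
  have hind : ∀ g : Horizon T × Ω → ℝ, (fun ω => D.indicator g (t, ω))
      = (Prod.mk t ⁻¹' D).indicator fun ω => g (t, ω) := fun g => rfl
  rw [hind, hind, integral_indicator (F.le t _ hDt), integral_indicator (F.le t _ hDt),
    ← setIntegral_condExp (F.le t) hft hDt]
  exact integral_congr_ae (ae_restrict_of_ae ht)

/-- The sections of the conditional expectation given the progressive `σ`-algebra are the
conditional expectations of the sections. -/
lemma condExp_progressive_section (hT : 0 < T) (F : Filtration (Horizon T) mΩ)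
    {f : Horizon T × Ω → ℝ} (hf : Integrable f (timeProd T P)) :
    ∀ᵐ t : Horizon T, (fun ω => ((timeProd T P)[f | progressiveSigma F]) (t, ω))
      =ᵐ[P] P[fun ω => f (t, ω) | F t] := by
  have hle := progressiveSigma_le hT F
  refine integrable_prod_induction (μ := (volume : Measure (Horizon T))) (ν := P)
    (fun f => ∀ᵐ t : Horizon T, (fun ω => ((timeProd T P)[f | progressiveSigma F]) (t, ω))
      =ᵐ[P] P[fun ω => f (t, ω) | F t]) ?_ ?_ ?_ ?_ hf
  · intro A B hA hB
    obtain ⟨w, hw, hwt⟩ := exists_progressive_martingale (P := P) F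
      (ξ := B.indicator fun _ => 1) ((memLp_const 1).indicator hB)
    have hAp : MeasurableSet[progressiveSigma F] (A ×ˢ (Set.univ : Set Ω)) :=
      measurableSet_prod_progressiveSigma hA fun _ _ => .univ
    -- For a rectangle the candidate is `1_A(t)` times the martingale closed by `1_B`.
    have h2 : ∀ᵐ t : Horizon T, (fun ω => (A ×ˢ (Set.univ : Set Ω)).indicator w (t, ω))
        =ᵐ[P] P[fun ω => (A ×ˢ B).indicator (fun _ => (1 : ℝ)) (t, ω) | F t] := by
      filter_upwards [hwt] with t ht
      by_cases hta : t ∈ A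
      · have e1 : (fun ω => (A ×ˢ (Set.univ : Set Ω)).indicator w (t, ω)) = fun ω => w (t, ω) := by
          ext ω; simp [hta]
        have e2 : (fun ω => (A ×ˢ B).indicator (fun _ => (1 : ℝ)) (t, ω))
            = B.indicator fun _ => 1 := by
          ext ω; by_cases hω : ω ∈ B <;> simp [hta, hω]
        rwa [e1, e2]
      · have e1 : (fun ω => (A ×ˢ (Set.univ : Set Ω)).indicator w (t, ω)) = 0 := by
          ext ω; simp [hta]
        have e2 : (fun ω => (A ×ˢ B).indicator (fun _ => (1 : ℝ)) (t, ω)) = 0 := by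
          ext ω; simp [hta]
        rw [e1, e2, condExp_zero]
    have hABint : Integrable ((A ×ˢ B).indicator fun _ => (1 : ℝ)) (timeProd T P) :=
      (integrable_const _).indicator (hA.prod hB)
    have h3 := ae_eq_condExp_progressive hT hABint (hw.indicator hAp) h2
    filter_upwards [h2, Measure.ae_ae_of_ae_prod h3] with t ht1 ht2
    exact (EventuallyEq.symm ht2).trans ht1
  · intro c f hf h
    filter_upwards [h, Measure.ae_ae_of_ae_prod (condExp_smul (μ := timeProd T P) c f (progressiveSigma F))]
      with t ht1 ht2
    filter_upwards [ht1, ht2, condExp_smul (μ := P) c (fun ω => f (t, ω)) (F t)] with ω h1 h2 h3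
    rw [h2]
    simp only [Pi.smul_apply] at h1 h3 ⊢
    rw [h1, ← h3]
    rfl
  · intro f g hf hg h h'
    filter_upwards [h, h', Measure.ae_ae_of_ae_prod (condExp_add hf hg (progressiveSigma F)),
      hf.prod_right_ae, hg.prod_right_ae] with t ht1 ht1' ht2 hft hgt
    filter_upwards [ht1, ht1', ht2, condExp_add hft hgt (F t)] with ω h1 h1' h2 h3
    rw [h2]
    simp only [Pi.add_apply] at h1 h1' h3 ⊢
    rw [h1, h1', ← h3]
    rfl
  · intro f g hf hg h hsum
    have hsum' : ∑' n, eLpNorm ((timeProd T P)[f n | progressiveSigma F]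
        - (timeProd T P)[g | progressiveSigma F]) 1 (timeProd T P) ≠ ∞ := by
      refine ne_top_of_le_ne_top hsum (ENNReal.tsum_le_tsum fun n => ?_)
      rw [← eLpNorm_congr_ae (condExp_sub (hf n) hg (progressiveSigma F))]
      exact eLpNorm_condExp_le_eLpNorm _ le_rfl
    filter_upwards [ae_tendsto_eLpNorm_section (fun n => (hf n).sub hg) hsum,
      ae_tendsto_eLpNorm_section (fun n => integrable_condExp.sub integrable_condExp) hsum',
      ae_all_iff.2 h, ae_all_iff.2 fun n => (hf n).prod_right_ae, hg.prod_right_ae,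
      (integrable_condExp (μ := timeProd T P) (f := g)
        (m := progressiveSigma F)).prod_right_ae] with t h1 h2 h3 hft hgt hpt
    -- The two objects agree for `f n`, so their discrepancy for `g` is controlled by the errors of
    -- `f n - g`. Both conditional expectations contract `L¹`, and both errors vanish along almost
    -- every section.
    have hbound : ∀ n, eLpNorm ((fun ω => ((timeProd T P)[g | progressiveSigma F]) (t, ω))
        - P[fun ω => g (t, ω) | F t]) 1 P
        ≤ eLpNorm (fun ω => ((timeProd T P)[f n | progressiveSigma F]
        - (timeProd T P)[g | progressiveSigma F]) (t, ω)) 1 P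
        + eLpNorm (fun ω => (f n - g) (t, ω)) 1 P := by
      intro n
      have e1 : ((fun ω => ((timeProd T P)[g | progressiveSigma F]) (t, ω))
          - P[fun ω => g (t, ω) | F t]) =ᵐ[P]
          -(fun ω => ((timeProd T P)[f n | progressiveSigma F]
            - (timeProd T P)[g | progressiveSigma F]) (t, ω))
          + P[fun ω => (f n - g) (t, ω) | F t] := by
        filter_upwards [h3 n, condExp_sub (hft n) hgt (F t)] with ω a1 a2
        have a2' : (P[fun ω => (f n - g) (t, ω) | F t]) ω = (P[fun ω => f n (t, ω) | F t]) ω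
          - (P[fun ω => g (t, ω) | F t]) ω := a2
        simp only [Pi.sub_apply, Pi.add_apply, Pi.neg_apply]
        rw [a1]
        change _ = _ + (P[fun ω => (f n - g) (t, ω) | F t]) ω
        rw [a2']
        ring
      rw [eLpNorm_congr_ae e1]
      refine (eLpNorm_add_le ?_ integrable_condExp.aestronglyMeasurable le_rfl).trans ?_
      · have hm : AEStronglyMeasurable (fun ω => (timeProd T P)[f n | progressiveSigma F] (t, ω))
            P := (integrable_condExp.aestronglyMeasurable).congr (h3 n).symm
        exact (hm.sub hpt.aestronglyMeasurable).neg
      · rw [eLpNorm_neg]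
        gcongr
        exact eLpNorm_condExp_le_eLpNorm _ le_rfl
    have hz : eLpNorm ((fun ω => ((timeProd T P)[g | progressiveSigma F]) (t, ω))
        - P[fun ω => g (t, ω) | F t]) 1 P ≤ 0 := by
      refine ge_of_tendsto' (x := (atTop : Filter ℕ)) ?_ hbound
      simpa using h2.add h1
    have hz' := (eLpNorm_eq_zero_iff
      (hpt.aestronglyMeasurable.sub integrable_condExp.aestronglyMeasurable) one_ne_zero).1
      (le_antisymm hz zero_le)
    filter_upwards [hz'] with ω hω
    exact sub_eq_zero.1 hω

end ConditionalSections

/-! ### Versions of families of conditional expectations -/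

section Versions

variable {T : ℝ} {Ω : Type*} [mΩ : MeasurableSpace Ω] {P : Measure Ω}

lemma SqIntProgressive.stronglyMeasurable {F : Filtration (Horizon T) mΩ} {u : RealProcess T Ω}
    (hT : 0 < T) (hu : u ∈ SqIntProgressive F P) : StronglyMeasurable (Function.uncurry u) :=
  (isStronglyProgressive_iff.1 hu.1).mono (progressiveSigma_le hT F)

/-- The existence half that keeps `version` away from its default value `0`; the conditional
expectation given the progressive `σ`-algebra is the witness. -/
lemma isVersion_condExp [IsProbabilityMeasure P] (hT : 0 < T) {F : Filtration (Horizon T) mΩ} {f : Horizon T × Ω → ℝ}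
    (hf : MemLp f 2 (timeProd T P)) {Y : Horizon T → Ω → ℝ}
    (hY : ∀ᵐ t : Horizon T, Y t =ᵐ[P] P[fun ω => f (t, ω) | F t]) :
    IsVersion F P Y (Function.curry ((timeProd T P)[f | progressiveSigma F])) := by
  refine ⟨⟨isStronglyProgressive_iff.2 ?_, hf.condExp one_le_two⟩, ?_⟩
  · rw [Function.uncurry_curry]
    exact stronglyMeasurable_condExp
  · filter_upwards [hY, condExp_progressive_section hT F (hf.integrable one_le_two)] with t h1 h2
    exact h2.trans h1.symm

lemma isVersion_version {F : Filtration (Horizon T) mΩ} {Y : Horizon T → Ω → ℝ}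
    (h : ∃ w, IsVersion F P Y w) : IsVersion F P Y (version F P Y) := by
  rw [version, dif_pos h]
  exact h.choose_spec

lemma IsVersion.ae_eq [IsProbabilityMeasure P] {F : Filtration (Horizon T) mΩ} {Y : Horizon T → Ω → ℝ}
    (hT : 0 < T) {w w' : RealProcess T Ω} (h : IsVersion F P Y w) (h' : IsVersion F P Y w') :
    Function.uncurry w =ᵐ[timeProd T P] Function.uncurry w' := by
  have hm : MeasurableSet {p : Horizon T × Ω | Function.uncurry w p = Function.uncurry w' p} :=
    measurableSet_eq_fun (SqIntProgressive.stronglyMeasurable hT h.1).measurable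
      (SqIntProgressive.stronglyMeasurable hT h'.1).measurable
  refine (Measure.ae_prod_iff_ae_ae hm).2 ?_
  filter_upwards [h.2, h'.2] with t h1 h2
  exact h1.trans h2.symm

/-- The version of the conditional expectations of the sections of a square integrable `f` is a
version of the conditional expectation of `f` given the progressive `σ`-algebra. -/
lemma version_spec [IsProbabilityMeasure P] (hT : 0 < T) {F : Filtration (Horizon T) mΩ} {f : Horizon T × Ω → ℝ}
    (hf : MemLp f 2 (timeProd T P)) {Y : Horizon T → Ω → ℝ}
    (hY : ∀ᵐ t : Horizon T, Y t =ᵐ[P] P[fun ω => f (t, ω) | F t]) :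
    version F P Y ∈ SqIntProgressive F P ∧
      ∀ v ∈ SqIntProgressive F P,
        ∫ p, Function.uncurry (version F P Y) p * Function.uncurry v p ∂(timeProd T P)
          = ∫ p, f p * Function.uncurry v p ∂(timeProd T P) := by
  have h0 := isVersion_condExp hT hf hY
  have h1 := isVersion_version ⟨_, h0⟩
  refine ⟨h1.1, fun v hv => ?_⟩
  have hprod : Integrable (f * Function.uncurry v) (timeProd T P) := hf.integrable_mul hv.2
  -- Since `v` is progressive it moves inside the conditional expectation, whose integral is that of
  -- `f v`.
  have h2 := condExp_mul_of_stronglyMeasurable_right (isStronglyProgressive_iff.1 hv.1) hprod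
    (hf.integrable one_le_two)
  change _ = ∫ p, (f * Function.uncurry v) p ∂(timeProd T P)
  rw [← integral_condExp (f := f * Function.uncurry v) (progressiveSigma_le hT F)]
  refine integral_congr_ae ?_
  filter_upwards [h1.ae_eq hT h0, h2] with p a1 a2
  rw [a1, a2]
  rfl

end Versions

/-! ### Bochner integrals in `L¹` computed pointwise -/

section SectionIntegral

variable {α β : Type*} [MeasurableSpace α] [MeasurableSpace β]

/-- The `L¹`-valued Bochner integral of the sections of an integrable function on a product. -/
lemma integral_section {μ : Measure α} {ν : Measure β} [IsFiniteMeasure μ]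
    [IsFiniteMeasure ν] {f : α × β → ℝ} (hf : Integrable f (μ.prod ν)) {Φ : α → Lp ℝ 1 ν}
    (hΦm : AEStronglyMeasurable Φ μ) (hΦ : ∀ᵐ a ∂μ, Φ a =ᵐ[ν] fun b => f (a, b)) :
    Integrable Φ μ ∧ ⇑(∫ a, Φ a ∂μ) =ᵐ[ν] fun b => ∫ a, f (a, b) ∂μ := by
  have hint : Integrable Φ μ := by
    refine hf.integral_norm_prod_left.mono hΦm ?_
    filter_upwards [hΦ] with a ha
    rw [L1.norm_eq_integral_norm, integral_congr_ae (show (fun b => ‖Φ a b‖) =ᵐ[ν] fun b => ‖f (a, b)‖ from ha.fun_comp norm)]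
    exact Real.le_norm_self _
  refine ⟨hint, ?_⟩
  refine Integrable.ae_eq_of_forall_setIntegral_eq _ _ (L1.integrable_coeFn _)
    hf.integral_prod_right fun B hB _ => ?_
  -- Integration over `B` is a continuous functional on `L¹`: it commutes with the Bochner integral,
  -- and Fubini then identifies the value. Letting `B` vary determines the class.
  let L : Lp ℝ 1 ν →L[ℝ] ℝ := LinearMap.mkContinuous
    { toFun := fun φ => ∫ b in B, φ b ∂ν
      map_add' := fun φ ψ => by
        rw [← integral_add (L1.integrable_coeFn φ).integrableOn
          (L1.integrable_coeFn ψ).integrableOn]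
        exact integral_congr_ae (ae_restrict_of_ae (Lp.coeFn_add φ ψ))
      map_smul' := fun c φ => by
        rw [RingHom.id_apply, smul_eq_mul, ← integral_const_mul]
        exact integral_congr_ae (ae_restrict_of_ae (Lp.coeFn_smul c φ)) } 1 fun φ => by
      rw [one_mul, L1.norm_eq_integral_norm]
      exact (norm_integral_le_integral_norm _).trans
        (setIntegral_le_integral (L1.integrable_coeFn φ).norm (.of_forall fun _ => norm_nonneg _))
  have hL : ∀ φ, L φ = ∫ b in B, φ b ∂ν := fun φ => rfl
  rw [← hL, ← L.integral_comp_comm hint]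
  have hfB : Integrable f (μ.prod (ν.restrict B)) := by
    have : μ.prod (ν.restrict B) = (μ.prod ν).restrict (Set.univ ×ˢ B) := by
      rw [← Measure.prod_restrict, Measure.restrict_univ]
    rw [this]
    exact hf.integrableOn
  rw [← integral_integral_swap (f := fun a b => f (a, b)) hfB]
  refine integral_congr_ae ?_
  filter_upwards [hΦ] with a ha
  rw [hL]
  exact integral_congr_ae (ae_restrict_of_ae ha)

end SectionIntegral

/-! ### Hilbert–Schmidt operators acting in the time variable -/

section SquareIntegrableKernels

variable {α Ω : Type*} [MeasurableSpace α] [MeasurableSpace Ω]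

/-- The integral operator with kernel `K`, acting on functions on `α × Ω`. -/
noncomputable def kernelInt (μ : Measure α) (K : α → α → ℝ) (f : α × Ω → ℝ) : α × Ω → ℝ :=
  fun p => ∫ s, K p.1 s * f (s, p.2) ∂μ

lemma memLp_two_prod_mul {μ : Measure α} {ν : Measure Ω} [SFinite μ] [SFinite ν] {f : α → ℝ}
    {g : Ω → ℝ} (hf : MemLp f 2 μ) (hg : MemLp g 2 ν) :
    MemLp (fun p : α × Ω => f p.1 * g p.2) 2 (μ.prod ν) := by
  refine (memLp_two_iff_integrable_sq (hf.1.comp_fst.mul hg.1.comp_snd)).2 ?_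
  simpa only [mul_pow, Pi.mul_apply] using hf.integrable_sq.mul_prod hg.integrable_sq

lemma memLp_two_prod_section {μ : Measure α} {ν : Measure Ω} [SFinite μ] [SFinite ν]
    {f : α × Ω → ℝ} (hf : MemLp f 2 (μ.prod ν)) : ∀ᵐ a ∂μ, MemLp (fun b => f (a, b)) 2 ν := by
  filter_upwards [hf.integrable_sq.prod_right_ae, hf.1.prodMk_left] with a h1 h2
  exact (memLp_two_iff_integrable_sq h2).2 h1

lemma memLp_two_prod_swap {μ : Measure α} {ν : Measure Ω} [SFinite μ] [SFinite ν]
    {f : α × Ω → ℝ} (hf : MemLp f 2 (μ.prod ν)) :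
    MemLp (fun p : Ω × α => f (p.2, p.1)) 2 (ν.prod μ) := by
  exact (memLp_two_iff_integrable_sq hf.1.prod_swap).2 hf.integrable_sq.swap

lemma eLpNorm_two_lt_top_iff {μ : Measure α} {f : α → ℝ} :
    eLpNorm f 2 μ < ∞ ↔ ∫⁻ x, ‖f x‖ₑ ^ 2 ∂μ < ∞ := by
  rw [eLpNorm_lt_top_iff_lintegral_rpow_enorm_lt_top (by simp) (by simp)]
  simp

/-- Fubini, justified because the kernel and the tensor product of `g` and `f` are both square
integrable. -/
lemma integral_kernel_mul {μ : Measure α} [SFinite μ] {K : α → α → ℝ}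
    (hK : MemLp (Function.uncurry K) 2 (μ.prod μ)) {f g : α → ℝ} (hf : MemLp f 2 μ)
    (hg : MemLp g 2 μ) :
    ∫ t, (∫ s, K t s * f s ∂μ) * g t ∂μ = ∫ s, f s * (∫ t, K t s * g t ∂μ) ∂μ := by
  have hint : Integrable (fun p : α × α => K p.1 p.2 * (g p.1 * f p.2)) (μ.prod μ) :=
    hK.integrable_mul (memLp_two_prod_mul hg hf)
  calc ∫ t, (∫ s, K t s * f s ∂μ) * g t ∂μ = ∫ t, ∫ s, K t s * (g t * f s) ∂μ ∂μ := by
        refine integral_congr_ae (.of_forall fun t => ?_)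
        simp only
        rw [← integral_mul_const]
        exact integral_congr_ae (.of_forall fun s => by ring)
    _ = ∫ s, ∫ t, K t s * (g t * f s) ∂μ ∂μ :=
        integral_integral_swap (f := fun t s => K t s * (g t * f s)) hint
    _ = _ := by
        refine integral_congr_ae (.of_forall fun s => ?_)
        simp only
        rw [← integral_const_mul]
        exact integral_congr_ae (.of_forall fun s => by ring)

lemma lintegral_kernel_sq_le {μ : Measure α} {k f : α → ℝ} (hk : AEStronglyMeasurable k μ)
    (hf : AEStronglyMeasurable f μ) :
    ‖∫ s, k s * f s ∂μ‖ₑ ^ 2 ≤ (∫⁻ s, ‖k s‖ₑ ^ 2 ∂μ) * ∫⁻ s, ‖f s‖ₑ ^ 2 ∂μ := by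
  have h1 : ‖∫ s, k s * f s ∂μ‖ₑ ≤ ∫⁻ s, ‖k s‖ₑ * ‖f s‖ₑ ∂μ := by
    refine (enorm_integral_le_lintegral_enorm _).trans_eq ?_
    simp_rw [enorm_mul]
  have h2 := ENNReal.lintegral_mul_le_Lp_mul_Lq μ Real.HolderConjugate.two_two hk.enorm hf.enorm
  have h3 := pow_le_pow_left₀ (zero_le) (h1.trans h2) 2
  refine h3.trans_eq ?_
  rw [mul_pow, ← ENNReal.rpow_natCast, ← ENNReal.rpow_natCast, ← ENNReal.rpow_mul,
    ← ENNReal.rpow_mul]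
  norm_num

/-- All `σ`-algebras are arguments so that it also applies on `[0, r] × Ω` with `F r`, which gives
progressiveness of `𝐆u`. -/
lemma stronglyMeasurable_integral_kernel_mul {β γ Ω : Type*} {mβ : MeasurableSpace β}
    {mγ : MeasurableSpace γ} {m : MeasurableSpace Ω} {ρ : Measure β} [SFinite ρ] {k : γ → β → ℝ}
    (hk : Measurable (Function.uncurry k)) {f : β × Ω → ℝ} (hf : StronglyMeasurable f) :
    StronglyMeasurable fun p : γ × Ω => ∫ s, k p.1 s * f (s, p.2) ∂ρ := by
  refine StronglyMeasurable.integral_prod_right' (f := fun q : (γ × Ω) × β =>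
    k q.1.1 q.2 * f (q.2, q.1.2)) ?_
  exact (hk.comp ((measurable_fst.comp measurable_fst).prodMk measurable_snd)).stronglyMeasurable.mul
    (hf.comp_measurable (measurable_snd.prodMk (measurable_snd.comp measurable_fst)))

variable {μ : Measure α} [IsFiniteMeasure μ] {P : Measure Ω} [IsFiniteMeasure P]
  {K : α → α → ℝ}

/-- Hilbert–Schmidt bound: after Cauchy–Schwarz in `s`, one factor depends on time only and the
other on `ω` only, so the double integral splits. -/
lemma memLp_kernelInt (hKm : Measurable (Function.uncurry K))
    (hK : MemLp (Function.uncurry K) 2 (μ.prod μ)) {f : α × Ω → ℝ} (hfm : StronglyMeasurable f)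
    (hf : MemLp f 2 (μ.prod P)) : MemLp (kernelInt μ K f) 2 (μ.prod P) := by
  refine ⟨(stronglyMeasurable_integral_kernel_mul hKm hfm).aestronglyMeasurable, ?_⟩
  rw [eLpNorm_two_lt_top_iff]
  have hK2 := eLpNorm_two_lt_top_iff.1 hK.2
  have hf2 := eLpNorm_two_lt_top_iff.1 hf.2
  rw [lintegral_prod _ (hK.1.enorm.pow_const 2)] at hK2
  rw [lintegral_prod_symm _ (hf.1.enorm.pow_const 2)] at hf2
  calc ∫⁻ p, ‖kernelInt μ K f p‖ₑ ^ 2 ∂(μ.prod P)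
      ≤ ∫⁻ p, (∫⁻ s, ‖K p.1 s‖ₑ ^ 2 ∂μ) * ∫⁻ s, ‖f (s, p.2)‖ₑ ^ 2 ∂μ ∂(μ.prod P) := by
        refine lintegral_mono fun p => lintegral_kernel_sq_le ?_ ?_
        · exact (hKm.comp measurable_prodMk_left).aestronglyMeasurable
        · exact (hfm.comp_measurable measurable_prodMk_right).aestronglyMeasurable
    _ = (∫⁻ t, ∫⁻ s, ‖K t s‖ₑ ^ 2 ∂μ ∂μ) * ∫⁻ ω, ∫⁻ s, ‖f (s, ω)‖ₑ ^ 2 ∂μ ∂P := by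
        refine lintegral_prod_mul (f := fun t => ∫⁻ s, ‖K t s‖ₑ ^ 2 ∂μ)
          (g := fun ω => ∫⁻ s, ‖f (s, ω)‖ₑ ^ 2 ∂μ) ?_ ?_
        · exact (Measurable.lintegral_prod_right' (hKm.enorm.pow_const 2)).aemeasurable
        · exact (Measurable.lintegral_prod_left' (hfm.measurable.enorm.pow_const 2)).aemeasurable
    _ < ∞ := ENNReal.mul_lt_top hK2 hf2

lemma integral_kernelInt_mul (hKm : Measurable (Function.uncurry K))
    (hK : MemLp (Function.uncurry K) 2 (μ.prod μ)) {f g : α × Ω → ℝ} (hfm : StronglyMeasurable f)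
    (hgm : StronglyMeasurable g) (hf : MemLp f 2 (μ.prod P)) (hg : MemLp g 2 (μ.prod P)) :
    ∫ p, kernelInt μ K f p * g p ∂(μ.prod P)
      = ∫ p, f p * kernelInt μ (fun t s => K s t) g p ∂(μ.prod P) := by
  have hK' : MemLp (Function.uncurry fun t s => K s t) 2 (μ.prod μ) := memLp_two_prod_swap hK
  have h1 : Integrable (fun p => kernelInt μ K f p * g p) (μ.prod P) :=
    (memLp_kernelInt hKm hK hfm hf).integrable_mul hg
  have h2 : Integrable (fun p => f p * kernelInt μ (fun t s => K s t) g p) (μ.prod P) :=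
    hf.integrable_mul (memLp_kernelInt (K := fun t s => K s t) (hKm.comp measurable_swap) hK' hgm hg)
  rw [integral_prod_symm _ h1, integral_prod_symm _ h2]
  refine integral_congr_ae ?_
  filter_upwards [memLp_two_prod_section (memLp_two_prod_swap hf),
    memLp_two_prod_section (memLp_two_prod_swap hg)] with ω h1 h2
  exact integral_kernel_mul hK h1 h2

lemma ae_integrable_kernel_mul
    (hK : MemLp (Function.uncurry K) 2 (μ.prod μ)) {f : α × Ω → ℝ}
    (hf : MemLp f 2 (μ.prod P)) :
    ∀ᵐ p ∂(μ.prod P), Integrable (fun s => K p.1 s * f (s, p.2)) μ := by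
  have h1 : ∀ᵐ p ∂(μ.prod P), MemLp (K p.1) 2 μ :=
    Measure.quasiMeasurePreserving_fst.ae (memLp_two_prod_section hK)
  have h2 : ∀ᵐ p ∂(μ.prod P), MemLp (fun s => f (s, p.2)) 2 μ :=
    Measure.quasiMeasurePreserving_snd.ae (memLp_two_prod_section (memLp_two_prod_swap hf))
  filter_upwards [h1, h2] with p a1 a2
  exact a1.integrable_mul a2

/-- Linearity can fail only where one of the two pathwise integrands is not integrable, so one null
set serves every `c`. -/
lemma kernelInt_add_smul
    (hK : MemLp (Function.uncurry K) 2 (μ.prod μ)) {f g : α × Ω → ℝ}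
    (hf : MemLp f 2 (μ.prod P)) (hg : MemLp g 2 (μ.prod P)) :
    ∀ᵐ p ∂(μ.prod P), ∀ c : ℝ, kernelInt μ K (f + c • g) p
      = kernelInt μ K f p + c * kernelInt μ K g p := by
  filter_upwards [ae_integrable_kernel_mul hK hf, ae_integrable_kernel_mul hK hg]
    with p h1 h2 c
  simp only [kernelInt]
  rw [← integral_const_mul, ← integral_add h1 (h2.const_mul c)]
  exact integral_congr_ae (.of_forall fun s => by
    simp only [Pi.add_apply, Pi.smul_apply, smul_eq_mul]; ring)

end SquareIntegrableKernels

/-! ### The operators `𝐆`, `𝐆*` and the alpha-signal on `𝓛²` -/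

section VolterraOperators

variable {T : ℝ} {Ω : Type*}

lemma IsAdmissibleKernel.memLp {G : Horizon T → Horizon T → ℝ} (hG : IsAdmissibleKernel G) :
    MemLp (Function.uncurry G) 2 ((volume : Measure (Horizon T)).prod volume) := by
  refine ⟨hG.measurable.aestronglyMeasurable, ?_⟩
  rw [eLpNorm_two_lt_top_iff, lintegral_prod _ (hG.measurable.enorm.pow_const 2).aemeasurable]
  obtain ⟨C, hC⟩ := hG.bounded
  refine lt_of_le_of_lt (lintegral_mono (g := fun _ => (C : ℝ≥0∞)) fun t => ?_) ?_
  · refine le_trans (le_of_eq ?_) (hC t)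
    rw [← lintegral_indicator measurableSet_Iic]
    refine lintegral_congr fun s => ?_
    by_cases hs : s ≤ t
    · simp [hs, Function.uncurry]
    · simp [hs, Function.uncurry, hG.volterra t s (not_le.1 hs)]
  · rw [lintegral_const]
    exact ENNReal.mul_lt_top ENNReal.coe_lt_top (measure_lt_top _ _)

lemma uncurry_kernelOp {G : Horizon T → Horizon T → ℝ} (hG : IsAdmissibleKernel G)
    (u : RealProcess T Ω) :
    Function.uncurry (kernelOp G u) = kernelInt volume G (Function.uncurry u) := by
  ext ⟨t, ω⟩
  refine setIntegral_eq_integral_of_forall_compl_eq_zero fun s hs => ?_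
  rw [hG.volterra t s (not_le.1 hs), zero_mul]

lemma inventoryKernel_admissible {φ ϱ : ℝ} (hφ : 0 ≤ φ) (hϱ : 0 ≤ ϱ) :
    IsAdmissibleKernel (inventoryKernel T φ ϱ) where
  measurable := by
    refine Measurable.ite (measurableSet_lt measurable_snd measurable_fst) ?_ measurable_const
    exact ((measurable_const.sub (measurable_subtype_coe.comp measurable_fst)).const_mul _).add_const _
  volterra t s hts := if_neg hts.le.not_gt
  bounded := by
    refine ⟨(φ * T + ϱ).toNNReal ^ 2 * (volume (Set.univ : Set (Horizon T))).toNNReal,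
      fun t => ?_⟩
    push_cast
    rw [ENNReal.coe_toNNReal (measure_ne_top _ _), ← lintegral_const]
    refine (setLIntegral_le_lintegral _ _).trans (lintegral_mono fun s => ?_)
    change _ ≤ ENNReal.ofReal (φ * T + ϱ) ^ 2
    gcongr
    rw [← ofReal_norm, Real.norm_eq_abs]
    refine ENNReal.ofReal_le_ofReal ?_
    have hT : 0 ≤ T := t.2.1.trans t.2.2
    have h1 : φ * (T - t) ≤ φ * T := by
      gcongr
      linarith [t.2.1]
    have h2 : 0 ≤ φ * (T - t) := mul_nonneg hφ (by linarith [t.2.2])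
    unfold inventoryKernel
    split_ifs
    · rw [abs_of_nonneg (by linarith)]
      linarith
    · rw [abs_zero]
      positivity

variable [mΩ : MeasurableSpace Ω] {P : Measure Ω}

lemma kernelOp_mem (hT : 0 < T) [IsProbabilityMeasure P] {F : Filtration (Horizon T) mΩ}
    {G : Horizon T → Horizon T → ℝ} (hG : IsAdmissibleKernel G) {u : RealProcess T Ω}
    (hu : u ∈ SqIntProgressive F P) : kernelOp G u ∈ SqIntProgressive F P := by
  refine ⟨fun r => ?_, ?_⟩
  -- For times up to `r` the kernel vanishes on `(t, r]`, so the integral may be taken over all of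
  -- `[0, r]`, where `u` is jointly measurable for `F r`.
  · have h1 : ∀ p : Set.Iic r × Ω, kernelOp G u p.1 p.2
        = ∫ s : Set.Iic r, G p.1 s * u s p.2 ∂(Measure.comap Subtype.val volume) := by
      intro p
      rw [integral_subtype_comap measurableSet_Iic (fun s => G p.1 s * u s p.2), kernelOp]
      refine setIntegral_eq_of_subset_of_forall_sdiff_eq_zero measurableSet_Iic
        (Set.Iic_subset_Iic.2 p.1.2) (fun s hs => ?_) |>.symm
      rw [hG.volterra _ s (not_le.1 hs.2), zero_mul]
    simp_rw [h1]
    refine stronglyMeasurable_integral_kernel_mul (mβ := Subtype.instMeasurableSpace)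
      (mγ := Subtype.instMeasurableSpace) (k := fun (t s : Set.Iic r) => G t s)
      (f := fun q : Set.Iic r × Ω => u q.1 q.2) ?_ (hu.1 r)
    exact hG.measurable.comp ((measurable_subtype_coe.comp measurable_fst).prodMk
      (measurable_subtype_coe.comp measurable_snd))
  · rw [uncurry_kernelOp hG]
    exact memLp_kernelInt hG.measurable hG.memLp (SqIntProgressive.stronglyMeasurable hT hu) hu.2

/-- For almost every `t`, the `L¹`-valued integral defining `𝐆*u` is the conditional expectation of
the pathwise integral. -/
lemma adjoint_family_ae_eq [IsProbabilityMeasure P] (F : Filtration (Horizon T) mΩ)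
    {G : Horizon T → Horizon T → ℝ} (hG : IsAdmissibleKernel G) {u : RealProcess T Ω}
    (hu : MemLp (Function.uncurry u) 2 (timeProd T P)) :
    ∀ᵐ t : Horizon T, ⇑(∫ s in Set.Ici t, G s t • condExpL1 (F.le t) P (u s))
      =ᵐ[P] P[fun ω => kernelInt volume (fun t s => G s t) (Function.uncurry u) (t, ω) | F t] := by
  obtain ⟨Φ, hΦm, hΦ⟩ := exists_aestronglyMeasurable_section (hu.integrable one_le_two)
  have hG' : MemLp (Function.uncurry fun t s => G s t) 2
      ((volume : Measure (Horizon T)).prod volume) := memLp_two_prod_swap hG.memLp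
  filter_upwards [memLp_two_prod_section hG'] with t ht
  have hGu : Integrable (fun p : Horizon T × Ω => G p.1 t * u p.1 p.2) (timeProd T P) :=
    (ht.comp_fst P).integrable_mul hu
  have hm : AEStronglyMeasurable (fun s => G s t • Φ s) (volume : Measure (Horizon T)) :=
    ht.1.smul hΦm
  have hsec : ∀ᵐ s : Horizon T, ⇑(G s t • Φ s) =ᵐ[P] fun ω => G s t * u s ω := by
    filter_upwards [hΦ] with s hs
    filter_upwards [Lp.coeFn_smul (G s t) (Φ s), hs] with ω h1 h2
    rw [h1, Pi.smul_apply, h2]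
    rfl
  obtain ⟨hint, heq⟩ := integral_section hGu hm hsec
  have heq' : ⇑(∫ s, G s t • Φ s) =ᵐ[P] fun ω =>
    kernelInt volume (fun t s => G s t) (Function.uncurry u) (t, ω) := heq
  -- Conditional expectation is a continuous linear map on `L¹`, so it leaves the Bochner integral;
  -- the Volterra property extends the range from `[t, T]` to `[0, T]`.
  have hL : (∫ s in Set.Ici t, G s t • condExpL1 (F.le t) P (u s))
      = condExpL1CLM ℝ (F.le t) P (∫ s, G s t • Φ s) := by
    rw [← ContinuousLinearMap.integral_comp_comm _ hint,
      setIntegral_eq_integral_of_forall_compl_eq_zero]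
    · refine integral_congr_ae ?_
      filter_upwards [hΦ] with s hs
      have hs' : Φ s =ᵐ[P] u s := hs
      rw [map_smul, ← condExpL1_congr_ae (F.le t) hs', condExpL1_eq (L1.integrable_coeFn (Φ s)),
        Integrable.toL1_coeFn]
    · intro s hs
      rw [hG.volterra s t (not_le.1 hs), zero_smul]
  rw [hL]
  refine EventuallyEq.trans (.of_eq ?_) (condExp_ae_eq_condExpL1 (F.le t) _).symm
  rw [← condExpL1_congr_ae (F.le t) heq', condExpL1_eq (L1.integrable_coeFn _),
    Integrable.toL1_coeFn]

/-- The operator `𝐆*` maps into `𝓛²` and is dual to `𝐆`. -/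
lemma adjointOp_spec (hT : 0 < T) [IsProbabilityMeasure P] {F : Filtration (Horizon T) mΩ}
    {G : Horizon T → Horizon T → ℝ} (hG : IsAdmissibleKernel G) {u : RealProcess T Ω}
    (hum : StronglyMeasurable (Function.uncurry u))
    (hu : MemLp (Function.uncurry u) 2 (timeProd T P)) :
    adjointOp F P G u ∈ SqIntProgressive F P ∧
      ∀ v ∈ SqIntProgressive F P,
        ∫ p, Function.uncurry (adjointOp F P G u) p * Function.uncurry v p ∂(timeProd T P)
          = ∫ p, Function.uncurry u p * Function.uncurry (kernelOp G v) p ∂(timeProd T P) := by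
  have hm' : Measurable (Function.uncurry fun t s => G s t) := hG.measurable.comp measurable_swap
  have hG' : MemLp (Function.uncurry fun t s => G s t) 2
      ((volume : Measure (Horizon T)).prod volume) := memLp_two_prod_swap hG.memLp
  -- Tested against progressive `v`, the projection onto progressive processes is invisible; only
  -- transposition of the kernel remains.
  obtain ⟨h1, h2⟩ := version_spec hT (memLp_kernelInt hm' hG' hum hu)
    (adjoint_family_ae_eq F hG hu)
  refine ⟨h1, fun v hv => ?_⟩
  rw [uncurry_kernelOp hG]
  exact (h2 v hv).trans (integral_kernelInt_mul hm' hG' hum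
    (SqIntProgressive.stronglyMeasurable hT hv) hu hv.2)

/-- The alpha-signal lies in `𝓛²` and represents `v ↦ E ∫₀ᵀ (S_T - S_t) v_t dt`. -/
lemma alphaSignal_spec (hT : 0 < T) [IsProbabilityMeasure P] {F : Filtration (Horizon T) mΩ}
    {S : RealProcess T Ω} (hS : S ∈ SqIntProgressive F P) (hST : MemLp (S (terminal hT)) 2 P) :
    alphaSignal hT F P S ∈ SqIntProgressive F P ∧
      ∀ v ∈ SqIntProgressive F P,
        ∫ p, Function.uncurry (alphaSignal hT F P S) p * Function.uncurry v p ∂(timeProd T P)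
          = ∫ p, (S (terminal hT) p.2 - S p.1 p.2) * Function.uncurry v p ∂(timeProd T P) :=
  version_spec hT (f := fun p => S (terminal hT) p.2 - S p.1 p.2)
    ((hST.comp_snd _).sub hS.2) (.of_forall fun _ => ae_eq_refl _)

end VolterraOperators

/-! ### Primitives in time and the inventory identities -/

section Primitives

variable {T : ℝ}

/-- The square of a total integral over a linearly ordered atomless space. -/
lemma sq_integral_eq {ν : Measure (Horizon T)} [IsFiniteMeasure ν] [NullSingletonClass ν]
    {f : Horizon T → ℝ} (hf : Integrable f ν) :
    (∫ t, f t ∂ν) ^ 2 = 2 * ∫ t, (∫ s in Set.Iic t, f s ∂ν) * f t ∂ν := by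
  have hprod : Integrable (fun p : Horizon T × Horizon T => f p.1 * f p.2) (ν.prod ν) :=
    hf.mul_prod hf
  have hind : Integrable (fun p : Horizon T × Horizon T =>
      {p : Horizon T × Horizon T | p.2 ≤ p.1}.indicator (fun p => f p.1 * f p.2) p) (ν.prod ν) :=
    hprod.indicator (measurableSet_le measurable_snd measurable_fst)
  have hdiff : Integrable (fun p : Horizon T × Horizon T => f p.1 * f p.2 -
      {p : Horizon T × Horizon T | p.2 ≤ p.1}.indicator (fun p => f p.1 * f p.2) p) (ν.prod ν) :=
    hprod.sub hind
  have h1 : ∀ t, ∫ s, {p : Horizon T × Horizon T | p.2 ≤ p.1}.indicator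
      (fun p => f p.1 * f p.2) (t, s) ∂ν = (∫ s in Set.Iic t, f s ∂ν) * f t := by
    intro t
    rw [← integral_indicator measurableSet_Iic, ← integral_mul_const]
    refine integral_congr_ae (.of_forall fun s => ?_)
    by_cases hs : s ≤ t <;> simp [hs, mul_comm]
  have h2 : ∀ s, ∫ t, (f t * f s - {p : Horizon T × Horizon T | p.2 ≤ p.1}.indicator
      (fun p => f p.1 * f p.2) (t, s)) ∂ν = (∫ t in Set.Iic s, f t ∂ν) * f s := by
    intro s
    rw [← integral_indicator measurableSet_Iic, ← integral_mul_const]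
    refine integral_congr_ae ?_
    -- The square splits into two triangles that agree after renaming variables; the diagonal
    -- belongs to only one of them but is null.
    have hne : ∀ᵐ t ∂ν, t ≠ s := by simp [ae_iff]
    filter_upwards [hne] with t ht
    rcases lt_or_gt_of_ne ht with h | h
    · simp [h.le, not_le.2 h]
    · simp [h.le, not_le.2 h]
  have hsum : (∫ t, f t ∂ν) ^ 2 = ∫ t, ∫ s, f t * f s ∂ν ∂ν := by
    simp_rw [integral_const_mul, integral_mul_const]
    ring
  have h3 : ∫ t, ∫ s, f t * f s ∂ν ∂ν
      = ∫ t, (∫ s in Set.Iic t, f s ∂ν) * f t ∂ν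
        + ∫ t, ∫ s, (f t * f s - {p : Horizon T × Horizon T | p.2 ≤ p.1}.indicator
          (fun p => f p.1 * f p.2) (t, s)) ∂ν ∂ν := by
    simp_rw [← h1]
    rw [← integral_prod _ hind, integral_integral (f := fun t s => f t * f s) hprod,
      ← integral_prod _ hdiff, ← integral_add hind hdiff]
    refine integral_congr_ae (.of_forall fun p => ?_)
    simp
  have h4 := integral_integral_swap (μ := ν) (ν := ν)
    (f := fun t s => f t * f s - {p : Horizon T × Horizon T | p.2 ≤ p.1}.indicator
          (fun p => f p.1 * f p.2) (t, s)) hdiff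
  rw [hsum, h3, h4]
  simp_rw [h2]
  ring

lemma volume_real_Ici (s : Horizon T) : (volume : Measure (Horizon T)).real (Set.Ici s) = T - s := by
  have himg : (Subtype.val '' (Set.Ici s) : Set ℝ) = Set.Icc (s : ℝ) T := by
    ext x
    constructor
    · rintro ⟨y, hy, rfl⟩
      exact ⟨hy, y.2.2⟩
    · rintro ⟨h1, h2⟩
      exact ⟨⟨x, s.2.1.trans h1, h2⟩, h1, rfl⟩
  rw [Measure.real, Measure.Subtype.volume_def, comap_subtype_coe_apply measurableSet_Icc, himg,
    Real.volume_Icc, ENNReal.toReal_ofReal (by linarith [s.2.2])]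

lemma volume_real_univ (hT : 0 < T) : (volume : Measure (Horizon T)).real Set.univ = T := by
  have h : (Set.univ : Set (Horizon T)) = Set.Ici ⟨0, le_rfl, hT.le⟩ := by
    ext x
    simpa using show (⟨0, le_rfl, hT.le⟩ : Horizon T) ≤ x from x.2.1
  rw [h, volume_real_Ici, sub_zero]

lemma setIntegral_Iic_terminal (hT : 0 < T) (f : Horizon T → ℝ) :
    ∫ s in Set.Iic (terminal hT), f s = ∫ s, f s := by
  have h : Set.Iic (terminal hT) = Set.univ := by
    ext x
    simpa using show x ≤ terminal hT from x.2.2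
  rw [h, setIntegral_univ]

/-- Fubini: the value `f s` is counted for all `t ∈ [s, T]`, a set of length `T - s`. -/
lemma integral_primitive {f : Horizon T → ℝ} (hf : Integrable f) :
    ∫ t, ∫ s in Set.Iic t, f s = ∫ t : Horizon T, (T - t) * f t := by
  have hprod : Integrable (fun p : Horizon T × Horizon T => f p.2) (volume.prod volume) :=
    hf.comp_snd _
  have hind : Integrable (fun p : Horizon T × Horizon T =>
      {p : Horizon T × Horizon T | p.2 ≤ p.1}.indicator (fun p => f p.2) p)
      (volume.prod volume) :=
    hprod.indicator (measurableSet_le measurable_snd measurable_fst)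
  have h1 : ∀ t, ∫ s in Set.Iic t, f s = ∫ s, {p : Horizon T × Horizon T | p.2 ≤ p.1}.indicator
      (fun p => f p.2) (t, s) := by
    intro t
    rw [← integral_indicator measurableSet_Iic]
    rfl
  have h2 : ∀ s, ∫ t, {p : Horizon T × Horizon T | p.2 ≤ p.1}.indicator
      (fun p => f p.2) (t, s) = (T - s) * f s := by
    intro s
    have : (fun t => {p : Horizon T × Horizon T | p.2 ≤ p.1}.indicator (fun p => f p.2) (t, s))
        = (Set.Ici s).indicator fun _ => f s := by
      ext t
      by_cases h : s ≤ t <;> simp [h]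
    rw [this, integral_indicator measurableSet_Ici, setIntegral_const, volume_real_Ici, smul_eq_mul]
  simp_rw [h1]
  rw [integral_integral_swap (f := fun t s => {p : Horizon T × Horizon T | p.2 ≤ p.1}.indicator
      (fun p => f p.2) (t, s)) hind]
  simp_rw [h2]

lemma integrable_primitive_mul {f : Horizon T → ℝ} (hf : MemLp f 2) :
    Integrable fun t => (∫ s in Set.Iic t, f s) * f t := by
  have hprod : Integrable (fun p : Horizon T × Horizon T => f p.1 * f p.2)
    (volume.prod volume) := (hf.integrable one_le_two).mul_prod (hf.integrable one_le_two)
  have hind := (hprod.indicator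
    (measurableSet_le (f := fun p : Horizon T × Horizon T => p.2) (g := fun p => p.1)
      measurable_snd measurable_fst)).integral_prod_left
  refine hind.congr (.of_forall fun t => ?_)
  simp only
  rw [← integral_indicator measurableSet_Iic, ← integral_mul_const]
  refine integral_congr_ae (.of_forall fun s => ?_)
  by_cases hs : s ≤ t <;> simp [hs, mul_comm]

/-- The chain rule in integrated form: the square of a primitive `Φ` of `f` has density `2 Φ f`. It
is the preceding square formula for Lebesgue measure restricted to `[0, t]`. -/
lemma sq_primitive {f : Horizon T → ℝ} (hf : MemLp f 2) (t : Horizon T) :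
    (∫ s in Set.Iic t, f s) ^ 2 = ∫ r in Set.Iic t, 2 * ((∫ s in Set.Iic r, f s) * f r) := by
  rw [sq_integral_eq (hf.integrable one_le_two).integrableOn, integral_const_mul]
  congr 1
  refine setIntegral_congr_fun measurableSet_Iic fun r hr => ?_
  rw [Measure.restrict_restrict measurableSet_Iic, Set.Iic_inter_Iic, min_eq_left hr]

variable {φ ϱ : ℝ}

lemma inventory_linear {f : Horizon T → ℝ} (hf : Integrable f) :
    φ * (∫ t, ∫ s in Set.Iic t, f s) + ϱ * ∫ s, f s
      = ∫ t : Horizon T, (φ * (T - t) + ϱ) * f t := by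
  have h1 : Integrable fun t : Horizon T => (T - t) * f t := by
    refine hf.bdd_mul (c := T) ?_ (.of_forall fun t => ?_)
    · exact (measurable_const.sub measurable_subtype_coe).aestronglyMeasurable
    · rw [Real.norm_eq_abs, abs_of_nonneg (by linarith [t.2.2])]
      linarith [t.2.1]
  rw [integral_primitive hf, ← integral_const_mul, ← integral_const_mul,
    ← integral_add (h1.const_mul _) (hf.const_mul _)]
  exact integral_congr_ae (.of_forall fun t => by simp only; ring)

/-- By `sq_primitive` the squared primitive is itself a primitive, so the linear identity applies to
it. This is where the kernel `H` comes from. -/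
lemma inventory_quadratic (hT : 0 < T) {f : Horizon T → ℝ} (hf : MemLp f 2) :
    φ * (∫ t, (∫ s in Set.Iic t, f s) ^ 2) + ϱ * (∫ s, f s) ^ 2
      = 2 * ∫ t : Horizon T, (φ * (T - t) + ϱ) * (∫ s in Set.Iic t, f s) * f t := by
  have h := inventory_linear (φ := φ) (ϱ := ϱ)
    (f := fun r => 2 * ((∫ s in Set.Iic r, f s) * f r)) ((integrable_primitive_mul hf).const_mul 2)
  have h2 := sq_primitive hf (terminal hT)
  rw [setIntegral_Iic_terminal, setIntegral_Iic_terminal] at h2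
  have h3 : ∫ t, (∫ s in Set.Iic t, f s) ^ 2
      = ∫ t, ∫ r in Set.Iic t, 2 * ((∫ s in Set.Iic r, f s) * f r) :=
    integral_congr_ae (.of_forall (sq_primitive hf))
  rw [h2, h3, h, ← integral_const_mul]
  exact integral_congr_ae (.of_forall fun t => by simp only; ring)

lemma kernelOp_inventoryKernel {Ω : Type*} (u : RealProcess T Ω) (t : Horizon T) (ω : Ω) :
    kernelOp (inventoryKernel T φ ϱ) u t ω = (φ * (T - t) + ϱ) * ∫ s in Set.Iic t, u s ω := by
  rw [kernelOp, ← integral_const_mul]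
  refine integral_congr_ae ?_
  have hne : ∀ᵐ s ∂((volume : Measure (Horizon T)).restrict (Set.Iic t)), s ≠ t :=
    ae_restrict_of_ae (by simp [ae_iff])
  filter_upwards [hne, ae_restrict_mem measurableSet_Iic] with s h1 h2
  rw [inventoryKernel, if_pos (lt_of_le_of_ne h2 h1)]

end Primitives

/-! ### Splitting integrals of several terms -/

section IntegralAlgebra

variable {α : Type*} [MeasurableSpace α] {μ : Measure α} {f₁ f₂ f₃ f₄ : α → ℝ}

lemma integral_add_three (h₁ : Integrable f₁ μ) (h₂ : Integrable f₂ μ) (h₃ : Integrable f₃ μ) :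
    ∫ a, (f₁ a + f₂ a + f₃ a) ∂μ = ∫ a, f₁ a ∂μ + ∫ a, f₂ a ∂μ + ∫ a, f₃ a ∂μ := by
  rw [← integral_add h₁ h₂]
  exact integral_add (h₁.add h₂) h₃

lemma integral_sub_sub_sub (h₁ : Integrable f₁ μ) (h₂ : Integrable f₂ μ) (h₃ : Integrable f₃ μ)
    (h₄ : Integrable f₄ μ) :
    ∫ a, (f₁ a - f₂ a - f₃ a - f₄ a) ∂μ
      = ∫ a, f₁ a ∂μ - ∫ a, f₂ a ∂μ - ∫ a, f₃ a ∂μ - ∫ a, f₄ a ∂μ := by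
  rw [← integral_sub h₁ h₂]
  refine (integral_sub ((h₁.sub h₂).sub h₃) h₄).trans ?_
  congr 1
  exact integral_sub (h₁.sub h₂) h₃

end IntegralAlgebra

/-! ### Stability of `𝓛²` under sums, multiples and the impact function -/

section Closure

variable {T : ℝ} {Ω : Type*} [mΩ : MeasurableSpace Ω] {P : Measure Ω}
  {F : Filtration (Horizon T) mΩ} {u v : RealProcess T Ω}

lemma SqIntProgressive.add (hu : u ∈ SqIntProgressive F P) (hv : v ∈ SqIntProgressive F P) :
    u + v ∈ SqIntProgressive F P :=
  ⟨fun r => (hu.1 r).add (hv.1 r), MemLp.add hu.2 hv.2⟩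

lemma SqIntProgressive.sub (hu : u ∈ SqIntProgressive F P) (hv : v ∈ SqIntProgressive F P) :
    u - v ∈ SqIntProgressive F P :=
  ⟨fun r => (hu.1 r).sub (hv.1 r), MemLp.sub hu.2 hv.2⟩

lemma SqIntProgressive.smul (c : ℝ) (hu : u ∈ SqIntProgressive F P) :
    c • u ∈ SqIntProgressive F P :=
  ⟨fun r => (hu.1 r).const_smul c, MemLp.const_smul hu.2 c⟩

lemma SqIntProgressive.ae_memLp_path [SFinite P] (hu : u ∈ SqIntProgressive F P) :
    ∀ᵐ ω ∂P, MemLp (fun t => u t ω) 2 volume :=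
  memLp_two_prod_section (memLp_two_prod_swap hu.2)

lemma measurable_weight (φ ϱ : ℝ) : Measurable fun t : Horizon T => φ * (T - (t : ℝ)) + ϱ :=
  ((measurable_const.sub measurable_subtype_coe).const_mul _).add_const _

lemma memLp_weight (φ ϱ : ℝ) : MemLp (fun t : Horizon T => φ * (T - (t : ℝ)) + ϱ) 2 volume := by
  refine MemLp.of_bound (measurable_weight φ ϱ).aestronglyMeasurable (|φ| * T + |ϱ|)
    (.of_forall fun t => ?_)
  refine (norm_add_le _ _).trans ?_
  rw [norm_mul, Real.norm_eq_abs, Real.norm_eq_abs, Real.norm_eq_abs,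
    abs_of_nonneg (a := T - (t : ℝ)) (by linarith [t.2.2])]
  gcongr
  linarith [t.2.1]

lemma weight_mem [IsProbabilityMeasure P] (F : Filtration (Horizon T) mΩ) (φ ϱ : ℝ) :
    (fun t _ => φ * (T - (t : ℝ)) + ϱ : RealProcess T Ω) ∈ SqIntProgressive F P := by
  refine ⟨fun r => ?_, (memLp_weight φ ϱ).comp_fst P⟩
  exact ((measurable_weight φ ϱ).comp
    (measurable_subtype_coe.comp measurable_fst)).stronglyMeasurable

lemma IsAdmissibleImpact.exists_lipschitz {h : ℝ → ℝ} (hh : IsAdmissibleImpact h) :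
    ∃ M : ℝ, 0 ≤ M ∧ (∀ x, |deriv h x| ≤ M) ∧ ∀ x y, |h x - h y| ≤ M * |x - y| := by
  obtain ⟨M, hM⟩ := hh.bounded_deriv
  refine ⟨M, (abs_nonneg _).trans (hM 0), hM, fun x y => ?_⟩
  exact convex_univ.norm_image_sub_le_of_norm_deriv_le
    (fun z _ => hh.differentiable z) (fun z _ => hM z) (Set.mem_univ y) (Set.mem_univ x)

variable {h : ℝ → ℝ}

lemma IsAdmissibleImpact.comp_mem [IsProbabilityMeasure P] (hh : IsAdmissibleImpact h)
    (hu : u ∈ SqIntProgressive F P) : (fun t ω => h (u t ω)) ∈ SqIntProgressive F P := by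
  refine ⟨fun r => hh.differentiable.continuous.comp_stronglyMeasurable (hu.1 r), ?_⟩
  obtain ⟨M, -, -, hL⟩ := hh.exists_lipschitz
  have habs : MemLp (fun p : Horizon T × Ω => |u p.1 p.2|) 2 (timeProd T P) := hu.2.norm
  have hconst : MemLp (fun _ : Horizon T × Ω => |h 0|) 2 (timeProd T P) := memLp_const _
  have hbound : MemLp (fun p : Horizon T × Ω => |h 0| + M * |u p.1 p.2|) 2 (timeProd T P) :=
    hconst.add (habs.const_mul M)
  refine hbound.mono (hh.differentiable.continuous.comp_aestronglyMeasurable hu.2.1)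
    (.of_forall fun p => ?_)
  have h1 := hL (u p.1 p.2) 0
  rw [sub_zero] at h1
  have h2 : |h (u p.1 p.2)| ≤ |h 0| + |h (u p.1 p.2) - h 0| := by
    have := abs_add_le (h 0) (h (u p.1 p.2) - h 0)
    rwa [add_sub_cancel] at this
  exact (h2.trans (by linarith)).trans (le_abs_self _)

lemma IsAdmissibleImpact.deriv_mul_mem (hh : IsAdmissibleImpact h) (hT : 0 < T)
    (hu : u ∈ SqIntProgressive F P) (hv : v ∈ SqIntProgressive F P) :
    (fun t ω => deriv h (u t ω) * v t ω) ∈ SqIntProgressive F P := by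
  obtain ⟨M, hM0, hM, -⟩ := hh.exists_lipschitz
  refine ⟨fun r => ?_, ?_⟩
  · exact ((measurable_deriv h).comp (hu.1 r).measurable).stronglyMeasurable.mul (hv.1 r)
  · have hm : Measurable (Function.uncurry u) :=
      (SqIntProgressive.stronglyMeasurable hT hu).measurable
    refine MemLp.of_le_mul (c := M) hv.2
      (((measurable_deriv h).comp hm).aestronglyMeasurable.mul hv.2.1) (.of_forall fun p => ?_)
    change ‖deriv h (u p.1 p.2) * v p.1 p.2‖ ≤ M * ‖v p.1 p.2‖
    rw [norm_mul]
    gcongr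
    exact hM _

end Closure

/-! ### The performance functional as an integral over `dt ⊗ P` -/

section Performance

variable {T : ℝ} {Ω : Type*} [mΩ : MeasurableSpace Ω] {P : Measure Ω} [IsProbabilityMeasure P]
  {F : Filtration (Horizon T) mΩ} {X₀ γ φ ϱ : ℝ} {h : ℝ → ℝ} {G : Horizon T → Horizon T → ℝ}
  {g S u v : RealProcess T Ω}

lemma distortion_mem (hT : 0 < T) (hg : g ∈ SqIntProgressive F P) (hG : IsAdmissibleKernel G)
    (hu : u ∈ SqIntProgressive F P) : distortion G g u ∈ SqIntProgressive F P :=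
  SqIntProgressive.add hg (kernelOp_mem hT hG hu)

lemma impactOp_mem (hT : 0 < T) (hg : g ∈ SqIntProgressive F P) (hG : IsAdmissibleKernel G)
    (hh : IsAdmissibleImpact h) (hu : u ∈ SqIntProgressive F P) :
    impactOp F P h G g u ∈ SqIntProgressive F P := by
  have hZ := distortion_mem hT hg hG hu
  have hd := hh.deriv_mul_mem hT hZ hu
  exact SqIntProgressive.add (hh.comp_mem hZ)
    (adjointOp_spec hT hG (SqIntProgressive.stronglyMeasurable hT hd) hd.2).1

/-- The integrand `u (S_T - S - X₀ (φ (T - t) + ϱ) - (γ/2) u - h(Z^u) - 𝐇u)` of the performance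
functional. -/
noncomputable def gainIntegrand (hT : 0 < T) (X₀ γ φ ϱ : ℝ) (h : ℝ → ℝ)
    (G : Horizon T → Horizon T → ℝ) (g S u : RealProcess T Ω) : RealProcess T Ω := fun t ω =>
  u t ω * (S (terminal hT) ω - S t ω - X₀ * (φ * (T - (t : ℝ)) + ϱ) - γ / 2 * u t ω
    - h (distortion G g u t ω) - kernelOp (inventoryKernel T φ ϱ) u t ω)

lemma memLp_bracket (hT : 0 < T) (hφ : 0 ≤ φ) (hϱ : 0 ≤ ϱ) (hS : S ∈ SqIntProgressive F P)
    (hST : MemLp (S (terminal hT)) 2 P) (hg : g ∈ SqIntProgressive F P)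
    (hG : IsAdmissibleKernel G) (hh : IsAdmissibleImpact h) (c : ℝ)
    (hu : u ∈ SqIntProgressive F P) :
    MemLp (fun p : Horizon T × Ω => S (terminal hT) p.2 - S p.1 p.2
      - X₀ * (φ * (T - (p.1 : ℝ)) + ϱ) - c * u p.1 p.2
      - h (distortion G g u p.1 p.2) - kernelOp (inventoryKernel T φ ϱ) u p.1 p.2) 2
      (timeProd T P) :=
  (((((hST.comp_snd _).sub hS.2).sub ((weight_mem F φ ϱ).2.const_mul X₀)).sub
    (hu.2.const_mul c)).sub (hh.comp_mem (distortion_mem hT hg hG hu)).2).sub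
    (kernelOp_mem hT (inventoryKernel_admissible hφ hϱ) hu).2

lemma integrable_gainIntegrand (hT : 0 < T) (hφ : 0 ≤ φ) (hϱ : 0 ≤ ϱ)
    (hS : S ∈ SqIntProgressive F P) (hST : MemLp (S (terminal hT)) 2 P)
    (hg : g ∈ SqIntProgressive F P) (hG : IsAdmissibleKernel G) (hh : IsAdmissibleImpact h)
    (hu : u ∈ SqIntProgressive F P) :
    Integrable (Function.uncurry (gainIntegrand hT X₀ γ φ ϱ h G g S u)) (timeProd T P) :=
  hu.2.integrable_mul (memLp_bracket hT hφ hϱ hS hST hg hG hh (γ / 2) hu)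

/-- The performance functional as an integral with respect to `dt ⊗ P`. -/
lemma performance_eq (hT : 0 < T) (hφ : 0 ≤ φ) (hϱ : 0 ≤ ϱ)
    (hS : S ∈ SqIntProgressive F P) (hST : MemLp (S (terminal hT)) 2 P)
    (hg : g ∈ SqIntProgressive F P) (hG : IsAdmissibleKernel G) (hh : IsAdmissibleImpact h)
    (hu : u ∈ SqIntProgressive F P) :
    performance hT P X₀ γ φ ϱ h G g S u
      = (∫ ω, (X₀ * S (terminal hT) ω - (φ * T + ϱ) * X₀ ^ 2 / 2) ∂P)
        + ∫ p, Function.uncurry (gainIntegrand hT X₀ γ φ ϱ h G g S u) p ∂(timeProd T P) := by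
  have hint := integrable_gainIntegrand (X₀ := X₀) (γ := γ) hT hφ hϱ hS hST hg hG hh hu
  have hconst : Integrable (fun ω => X₀ * S (terminal hT) ω - (φ * T + ϱ) * X₀ ^ 2 / 2) P :=
    ((hST.integrable one_le_two).const_mul _).sub (integrable_const _)
  rw [integral_prod_symm _ hint, ← integral_add hconst hint.integral_prod_right]
  refine integral_congr_ae ?_
  -- With `φ = 0` and `ϱ = 1` the inventory operator is the plain primitive, so `kernelOp_mem`
  -- yields square integrability of inventory paths.
  have hprim : IsAdmissibleKernel (inventoryKernel T 0 1) :=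
    inventoryKernel_admissible le_rfl zero_le_one
  filter_upwards [SqIntProgressive.ae_memLp_path hu, SqIntProgressive.ae_memLp_path hS,
    SqIntProgressive.ae_memLp_path (hh.comp_mem (distortion_mem hT hg hG hu)),
    SqIntProgressive.ae_memLp_path (kernelOp_mem hT hprim hu)] with ω hu hS hZ hX
  simp only [kernelOp_inventoryKernel, zero_mul, zero_add, one_mul] at hX
  simp only [Function.uncurry_apply_pair, gainIntegrand, executionPrice, inventory,
    setIntegral_Iic_terminal, kernelOp_inventoryKernel]
  have hlin := inventory_linear (φ := φ) (ϱ := ϱ) (hu.integrable one_le_two)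
  have hquad := inventory_quadratic (φ := φ) (ϱ := ϱ) hT hu
  have i1 : Integrable (fun t => (S t ω + γ / 2 * u t ω + h (distortion G g u t ω)) * u t ω) :=
    ((hS.add (hu.const_mul _)).add hZ).integrable_mul hu
  have i2 : Integrable (fun t => S (terminal hT) ω * u t ω) :=
    (hu.integrable one_le_two).const_mul _
  have i3 : Integrable (fun t : Horizon T => (φ * (T - t) + ϱ) * u t ω) :=
    (memLp_weight φ ϱ).integrable_mul hu
  have i4 : Integrable (fun t : Horizon T =>
      (φ * (T - t) + ϱ) * (∫ s in Set.Iic t, u s ω) * u t ω) := by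
    have hb : MemLp (fun t : Horizon T => (φ * (T - t) + ϱ) * (∫ s in Set.Iic t, u s ω)) 2 := by
      refine MemLp.of_le_mul (c := |φ| * T + |ϱ|) hX
        ((measurable_weight φ ϱ).aestronglyMeasurable.mul hX.1) (.of_forall fun t => ?_)
      rw [norm_mul]
      gcongr
      refine (norm_add_le _ _).trans ?_
      rw [norm_mul, Real.norm_eq_abs, Real.norm_eq_abs, Real.norm_eq_abs,
        abs_of_nonneg (a := T - (t : ℝ)) (by linarith [t.2.2])]
      gcongr
      linarith [t.2.1]
    exact hb.integrable_mul hu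
  have e1 : ∫ t, (X₀ + ∫ s in Set.Iic t, u s ω) ^ 2 = T * X₀ ^ 2
      + 2 * X₀ * (∫ t, ∫ s in Set.Iic t, u s ω) + ∫ t, (∫ s in Set.Iic t, u s ω) ^ 2 := by
    have j1 : Integrable (fun t => 2 * X₀ * (∫ s in Set.Iic t, u s ω)) :=
      (hX.integrable one_le_two).const_mul _
    have j2 : Integrable (fun t => (∫ s in Set.Iic t, u s ω) ^ 2) := hX.integrable_sq
    have j0 : Integrable (fun _ : Horizon T => X₀ ^ 2) := integrable_const _
    have : ∀ t, (X₀ + ∫ s in Set.Iic t, u s ω) ^ 2 = X₀ ^ 2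
      + 2 * X₀ * (∫ s in Set.Iic t, u s ω) + (∫ s in Set.Iic t, u s ω) ^ 2 := fun t => by ring
    simp_rw [this]
    rw [integral_add_three j0 j1 j2, integral_const_mul, integral_const,
      volume_real_univ hT, smul_eq_mul]
  have e2 : ∫ t : Horizon T, u t ω * (S (terminal hT) ω - S t ω - X₀ * (φ * (T - t) + ϱ)
      - γ / 2 * u t ω - h (distortion G g u t ω)
      - (φ * (T - t) + ϱ) * ∫ s in Set.Iic t, u s ω)
      = S (terminal hT) ω * (∫ t, u t ω)
        - (∫ t, (S t ω + γ / 2 * u t ω + h (distortion G g u t ω)) * u t ω)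
        - X₀ * (∫ t : Horizon T, (φ * (T - t) + ϱ) * u t ω)
        - ∫ t : Horizon T, (φ * (T - t) + ϱ) * (∫ s in Set.Iic t, u s ω) * u t ω := by
    rw [← integral_const_mul, ← integral_const_mul,
      ← integral_sub_sub_sub i2 i1 (i3.const_mul X₀) i4]
    exact integral_congr_ae (.of_forall fun t => by simp only; ring)
  rw [e1, e2]
  -- Expanding the squares of `X₀` plus the primitive, the cross terms carry `X₀` times the linear
  -- identity and the pure squares half the quadratic one.
  linear_combination (-X₀) * hlin - 1 / 2 * hquad

end Performance

/-! ### Differentiation of the gain under the integral -/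

section GainDerivative

/-- For `|ε| < 1` the pointwise derivative is dominated by `B`, a sum of products of square
integrable functions, thanks to the bound `M` on `h'`. In the application `z` is `Z^u`, `y` is `𝐆d`,
and `x`, `x'` are `𝐇u`, `𝐇d`. -/
lemma hasDerivAt_integral_gain {α : Type*} [MeasurableSpace α] {μ : Measure α}
    {h : ℝ → ℝ} (hh : IsAdmissibleImpact h) (γ : ℝ) {a u d z y x x' : α → ℝ} (ha : MemLp a 2 μ)
    (hu : MemLp u 2 μ) (hd : MemLp d 2 μ) (hz : AEStronglyMeasurable z μ)
    (hhz : MemLp (fun p => h (z p)) 2 μ) (hy : MemLp y 2 μ) (hx : MemLp x 2 μ)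
    (hx' : MemLp x' 2 μ) :
    HasDerivAt (fun ε : ℝ => ∫ p, (u p + ε * d p) * (a p - γ / 2 * (u p + ε * d p)
        - h (z p + ε * y p) - (x p + ε * x' p)) ∂μ)
      (∫ p, (d p * (a p - γ * u p - h (z p) - x p) - u p * (deriv h (z p) * y p + x' p)) ∂μ) 0 := by
  obtain ⟨M, hM0, hM, hL⟩ := hh.exists_lipschitz
  set f : ℝ → α → ℝ := fun ε p => (u p + ε * d p) * (a p - γ / 2 * (u p + ε * d p)
        - h (z p + ε * y p) - (x p + ε * x' p)) with hf
  set f' : ℝ → α → ℝ := fun ε p => d p * (a p - γ / 2 * (u p + ε * d p)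
        - h (z p + ε * y p) - (x p + ε * x' p))
        + (u p + ε * d p) * (-(γ / 2 * d p) - deriv h (z p + ε * y p) * y p - x' p) with hf'
  set B : α → ℝ := fun p => |d p| * (|a p| + |γ / 2| * (|u p| + |d p|) + (|h (z p)| + M * |y p|)
      + (|x p| + |x' p|)) + (|u p| + |d p|) * (|γ / 2| * |d p| + M * |y p| + |x' p|) with hB
  have hmeas : ∀ ε, AEStronglyMeasurable (f ε) μ := by
    intro ε
    have h1 : AEStronglyMeasurable (fun p => u p + ε * d p) μ := hu.1.add (hd.1.const_mul ε)
    exact h1.mul (((ha.1.sub (h1.const_mul _)).sub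
      (hh.differentiable.continuous.comp_aestronglyMeasurable (hz.add (hy.1.const_mul ε)))).sub
      (hx.1.add (hx'.1.const_mul ε)))
  have hint : Integrable (f 0) μ := by
    have h1 : MemLp (fun p => a p - γ / 2 * u p - h (z p) - x p) 2 μ :=
      ((ha.sub (hu.const_mul _)).sub hhz).sub hx
    refine (hu.integrable_mul h1).congr (.of_forall fun p => ?_)
    simp [hf]
  have hmeas' : AEStronglyMeasurable (f' 0) μ := by
    have h1 : AEStronglyMeasurable (fun p => deriv h (z p + 0 * y p)) μ :=
      ((measurable_deriv h).comp_aemeasurable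
        (hz.add (hy.1.const_mul 0)).aemeasurable).aestronglyMeasurable
    have h2 : AEStronglyMeasurable (fun p => u p + 0 * d p) μ := hu.1.add (hd.1.const_mul 0)
    exact (hd.1.mul (((ha.1.sub (h2.const_mul _)).sub
      (hh.differentiable.continuous.comp_aestronglyMeasurable (hz.add (hy.1.const_mul 0)))).sub
      (hx.1.add (hx'.1.const_mul 0)))).add
      (h2.mul (((hd.1.const_mul _).neg.sub (h1.mul hy.1)).sub hx'.1))
  have hBint : Integrable B μ := by
    have b1 : MemLp (fun p => |a p| + |γ / 2| * (|u p| + |d p|) + (|h (z p)| + M * |y p|)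
      + (|x p| + |x' p|)) 2 μ :=
      ((ha.norm.add ((hu.norm.add hd.norm).const_mul _)).add
        (hhz.norm.add (hy.norm.const_mul M))).add (hx.norm.add hx'.norm)
    have b2 : MemLp (fun p => |γ / 2| * |d p| + M * |y p| + |x' p|) 2 μ :=
      ((hd.norm.const_mul _).add (hy.norm.const_mul M)).add hx'.norm
    exact (hd.norm.integrable_mul b1).add ((hu.norm.add hd.norm).integrable_mul b2)
  have hbound : ∀ᵐ p ∂μ, ∀ ε ∈ Metric.ball (0 : ℝ) 1, ‖f' ε p‖ ≤ B p := by
    refine .of_forall fun p ε hε => ?_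
    have hε' : |ε| ≤ 1 := by
      rw [Metric.mem_ball, dist_zero_right] at hε
      exact hε.le
    have hmul : ∀ r : ℝ, |ε * r| ≤ |r| := fun r => by
      rw [abs_mul]
      exact mul_le_of_le_one_left (abs_nonneg r) hε'
    have e1 : |u p + ε * d p| ≤ |u p| + |d p| :=
      (abs_add_le _ _).trans (add_le_add le_rfl (hmul _))
    have e2 : |x p + ε * x' p| ≤ |x p| + |x' p| :=
      (abs_add_le _ _).trans (add_le_add le_rfl (hmul _))
    have e3 : |h (z p + ε * y p)| ≤ |h (z p)| + M * |y p| := by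
      have h1 := hL (z p + ε * y p) (z p)
      rw [add_sub_cancel_left] at h1
      have h2 := abs_add_le (h (z p)) (h (z p + ε * y p) - h (z p))
      rw [add_sub_cancel] at h2
      have h3 := mul_le_mul_of_nonneg_left (hmul (y p)) hM0
      linarith
    rw [Real.norm_eq_abs]
    refine (abs_add_le _ _).trans (add_le_add ?_ ?_)
    · rw [abs_mul]
      gcongr
      refine (abs_sub _ _).trans (add_le_add ((abs_sub _ _).trans (add_le_add
        ((abs_sub _ _).trans (add_le_add le_rfl ?_)) e3)) e2)
      rw [abs_mul]
      gcongr
    · rw [abs_mul]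
      gcongr
      refine (abs_sub _ _).trans (add_le_add ((abs_sub _ _).trans (add_le_add ?_ ?_)) le_rfl)
      · rw [abs_neg, abs_mul]
      · rw [abs_mul]
        gcongr
        exact hM _
  have hdiff : ∀ᵐ p ∂μ, ∀ ε ∈ Metric.ball (0 : ℝ) 1, HasDerivAt (f · p) (f' ε p) ε := by
    refine .of_forall fun p ε _ => ?_
    have lin : ∀ b c : ℝ, HasDerivAt (fun ε : ℝ => b + ε * c) c ε := fun b c => by
      simpa using ((hasDerivAt_id ε).mul_const c).const_add b
    have h1 : HasDerivAt (fun ε : ℝ => h (z p + ε * y p)) (deriv h (z p + ε * y p) * y p) ε :=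
      (hh.differentiable _).hasDerivAt.comp ε (lin (z p) (y p))
    have h2 := (lin (u p) (d p)).mul (((((lin (u p) (d p)).const_mul (γ / 2)).const_sub (a p)).sub
      h1).sub (lin (x p) (x' p)))
    exact h2
  have key := (hasDerivAt_integral_of_dominated_loc_of_deriv_le (F := f) (F' := f')
    (Metric.ball_mem_nhds (0 : ℝ) one_pos) (.of_forall hmeas) hint hmeas' hbound hBint hdiff).2
  refine key.congr_deriv (integral_congr_ae (.of_forall fun p => ?_))
  simp only [hf', zero_mul, add_zero]
  ring

end GainDerivative

/-! ### The gradient, its strong monotonicity, and strong concavity -/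

section Gradient

variable {T : ℝ} {Ω : Type*} [mΩ : MeasurableSpace Ω] {P : Measure Ω} [IsProbabilityMeasure P]
  {F : Filtration (Horizon T) mΩ} {X₀ γ φ ϱ : ℝ} {h : ℝ → ℝ} {G : Horizon T → Horizon T → ℝ}
  {g S u v d : RealProcess T Ω}

/-- The residual `γ u + 𝐀(u) + 𝐇u + 𝐇*u - (α - X₀ (φ (T - t) + ϱ))` of the Fredholm equation; it
is minus the gradient of the performance functional. -/
noncomputable def residual (hT : 0 < T) (F : Filtration (Horizon T) mΩ) (P : Measure Ω)
    [IsProbabilityMeasure P] (X₀ γ φ ϱ : ℝ) (h : ℝ → ℝ)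
    (G : Horizon T → Horizon T → ℝ) (g S u : RealProcess T Ω) : RealProcess T Ω := fun t ω =>
  γ * u t ω + impactOp F P h G g u t ω + kernelOp (inventoryKernel T φ ϱ) u t ω
    + adjointOp F P (inventoryKernel T φ ϱ) u t ω
    - (alphaSignal hT F P S t ω - X₀ * (φ * (T - (t : ℝ)) + ϱ))

lemma solvesFredholm_iff (hT : 0 < T) : SolvesFredholm hT F P X₀ γ φ ϱ h G g S u ↔
    u ∈ SqIntProgressive F P ∧
      ∀ᵐ p ∂(timeProd T P), residual hT F P X₀ γ φ ϱ h G g S u p.1 p.2 = 0 := by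
  simp only [SolvesFredholm, EqAE, residual, sub_eq_zero]

lemma residual_mem (hT : 0 < T) (hφ : 0 ≤ φ) (hϱ : 0 ≤ ϱ) (hS : S ∈ SqIntProgressive F P)
    (hST : MemLp (S (terminal hT)) 2 P) (hg : g ∈ SqIntProgressive F P)
    (hG : IsAdmissibleKernel G) (hh : IsAdmissibleImpact h) (hu : u ∈ SqIntProgressive F P) :
    residual hT F P X₀ γ φ ϱ h G g S u ∈ SqIntProgressive F P := by
  have hH : IsAdmissibleKernel (inventoryKernel T φ ϱ) := inventoryKernel_admissible hφ hϱ
  exact SqIntProgressive.sub (SqIntProgressive.add (SqIntProgressive.add (SqIntProgressive.add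
    (SqIntProgressive.smul γ hu) (impactOp_mem hT hg hG hh hu)) (kernelOp_mem hT hH hu))
    (adjointOp_spec hT hH (SqIntProgressive.stronglyMeasurable hT hu) hu.2).1)
    (SqIntProgressive.sub (alphaSignal_spec hT hS hST).1
      (SqIntProgressive.smul X₀ (weight_mem F φ ϱ)))

lemma integrable_mul_of_mem {P : Measure Ω} (hu : u ∈ SqIntProgressive F P) (hv : v ∈ SqIntProgressive F P) :
    Integrable (fun p : Horizon T × Ω => u p.1 p.2 * v p.1 p.2) (timeProd T P) :=
  hu.2.integrable_mul hv.2

/-- The residual paired with a direction, in terms of pathwise quantities. -/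
lemma integral_residual_mul (hT : 0 < T) (hφ : 0 ≤ φ) (hϱ : 0 ≤ ϱ) (hS : S ∈ SqIntProgressive F P)
    (hST : MemLp (S (terminal hT)) 2 P) (hg : g ∈ SqIntProgressive F P)
    (hG : IsAdmissibleKernel G) (hh : IsAdmissibleImpact h) (hu : u ∈ SqIntProgressive F P)
    (hd : d ∈ SqIntProgressive F P) :
    ∫ p, residual hT F P X₀ γ φ ϱ h G g S u p.1 p.2 * d p.1 p.2 ∂(timeProd T P)
      = -∫ p, (d p.1 p.2 * (S (terminal hT) p.2 - S p.1 p.2 - X₀ * (φ * (T - (p.1 : ℝ)) + ϱ)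
        - γ * u p.1 p.2 - h (distortion G g u p.1 p.2)
        - kernelOp (inventoryKernel T φ ϱ) u p.1 p.2)
        - u p.1 p.2 * (deriv h (distortion G g u p.1 p.2) * kernelOp G d p.1 p.2
          + kernelOp (inventoryKernel T φ ϱ) d p.1 p.2)) ∂(timeProd T P) := by
  have hH : IsAdmissibleKernel (inventoryKernel T φ ϱ) := inventoryKernel_admissible hφ hϱ
  have hZ := distortion_mem hT hg hG hu
  have hD := hh.deriv_mul_mem hT hZ hu
  have hA1 := adjointOp_spec (F := F) hT hG (SqIntProgressive.stronglyMeasurable hT hD) hD.2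
  have hA2 := adjointOp_spec (F := F) hT hH (SqIntProgressive.stronglyMeasurable hT hu) hu.2
  have hα := alphaSignal_spec hT hS hST
  have p1 := hA1.2 d hd
  have p2 := hA2.2 d hd
  have p3 := hα.2 d hd
  simp only [Function.uncurry_def] at p1 p2 p3
  have q1 := integrable_mul_of_mem hA1.1 hd
  have q2 := integrable_mul_of_mem hA2.1 hd
  have q3 := integrable_mul_of_mem hα.1 hd
  have r1 := integrable_mul_of_mem hD (kernelOp_mem hT hG hd)
  have r2 := integrable_mul_of_mem hu (kernelOp_mem hT hH hd)
  have r3 : Integrable (fun p : Horizon T × Ω =>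
      (S (terminal hT) p.2 - S p.1 p.2) * d p.1 p.2) (timeProd T P) :=
    ((hST.comp_snd _).sub hS.2).integrable_mul hd.2
  -- `q0` collects the terms common to both sides; the two adjoint terms and the alpha-signal are
  -- exchanged for pathwise quantities by duality.
  have q0 := integrable_mul_of_mem (SqIntProgressive.sub (SqIntProgressive.add
    (SqIntProgressive.add (SqIntProgressive.smul γ hu) (hh.comp_mem hZ)) (kernelOp_mem hT hH hu))
    (SqIntProgressive.smul (-X₀) (weight_mem F φ ϱ))) hd
  simp only [Pi.add_apply, Pi.sub_apply, Pi.smul_apply, smul_eq_mul] at q0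
  have lhs := integral_sub_sub_sub q0 q1.neg q2.neg q3
  have rhs := integral_sub_sub_sub q0 r1.neg r2.neg r3
  simp only [Pi.neg_apply, integral_neg] at lhs rhs
  rw [p1, p2, p3, ← rhs] at lhs
  rw [← integral_neg]
  calc _ = _ := integral_congr_ae (.of_forall fun p => ?_)
    _ = _ := lhs
    _ = _ := integral_congr_ae (.of_forall fun p => ?_)
  · simp only [residual, impactOp]
    ring
  · simp only
    ring

lemma kernelOp_add_smul (hG : IsAdmissibleKernel G) (hu : u ∈ SqIntProgressive F P)
    (hd : d ∈ SqIntProgressive F P) :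
    ∀ᵐ p ∂(timeProd T P), ∀ ε : ℝ, kernelOp G (u + ε • d) p.1 p.2
      = kernelOp G u p.1 p.2 + ε * kernelOp G d p.1 p.2 := by
  filter_upwards [kernelInt_add_smul hG.memLp hu.2 hd.2] with p hp ε
  have e : ∀ w : RealProcess T Ω,
      kernelOp G w p.1 p.2 = kernelInt volume G (Function.uncurry w) p := fun w =>
    congrFun (uncurry_kernelOp hG w) p
  rw [e, e, e, ← hp ε]
  rfl

/-- The directional derivatives of the performance functional. -/
lemma hasDerivAt_performance (hT : 0 < T) (hφ : 0 ≤ φ) (hϱ : 0 ≤ ϱ)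
    (hS : S ∈ SqIntProgressive F P) (hST : MemLp (S (terminal hT)) 2 P)
    (hg : g ∈ SqIntProgressive F P) (hG : IsAdmissibleKernel G) (hh : IsAdmissibleImpact h)
    (hu : u ∈ SqIntProgressive F P) (hd : d ∈ SqIntProgressive F P) :
    HasDerivAt (fun ε : ℝ => performance hT P X₀ γ φ ϱ h G g S (u + ε • d))
      (-∫ p, residual hT F P X₀ γ φ ϱ h G g S u p.1 p.2 * d p.1 p.2 ∂(timeProd T P)) 0 := by
  have hH : IsAdmissibleKernel (inventoryKernel T φ ϱ) := inventoryKernel_admissible hφ hϱ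
  have hZ := distortion_mem hT hg hG hu
  have ha : MemLp (fun p : Horizon T × Ω => S (terminal hT) p.2 - S p.1 p.2
      - X₀ * (φ * (T - (p.1 : ℝ)) + ϱ)) 2 (timeProd T P) :=
    ((hST.comp_snd _).sub hS.2).sub ((weight_mem F φ ϱ).2.const_mul X₀)
  have key := hasDerivAt_integral_gain hh γ ha hu.2 hd.2 hZ.2.1 (hh.comp_mem hZ).2
    (kernelOp_mem hT hG hd).2 (kernelOp_mem hT hH hu).2 (kernelOp_mem hT hH hd).2
  rw [integral_residual_mul hT hφ hϱ hS hST hg hG hh hu hd, neg_neg]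
  simp_rw [fun ε : ℝ => performance_eq (X₀ := X₀) (γ := γ) hT hφ hϱ hS hST hg hG hh
    (SqIntProgressive.add hu (SqIntProgressive.smul ε hd))]
  refine HasDerivAt.const_add _ (key.congr_of_eventuallyEq (.of_forall fun ε => ?_))
  refine integral_congr_ae ?_
  filter_upwards [kernelOp_add_smul hG hu hd, kernelOp_add_smul hH hu hd] with p h1 h2
  simp only [Function.uncurry_def, gainIntegrand, distortion]
  rw [h1, h2]
  simp only [Pi.add_apply, Pi.smul_apply, smul_eq_mul]
  ring_nf

/-- Path by path, twice the pairing is the sum of squares `φ ∫ D² + ϱ D_T²`, where `D` is the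
primitive of `d`. -/
lemma integral_mul_kernelOp_inventoryKernel_nonneg (hT : 0 < T) (hφ : 0 ≤ φ) (hϱ : 0 ≤ ϱ)
    (hd : d ∈ SqIntProgressive F P) :
    0 ≤ ∫ p, d p.1 p.2 * kernelOp (inventoryKernel T φ ϱ) d p.1 p.2 ∂(timeProd T P) := by
  have hH : IsAdmissibleKernel (inventoryKernel T φ ϱ) := inventoryKernel_admissible hφ hϱ
  rw [integral_prod_symm _ (integrable_mul_of_mem hd (kernelOp_mem hT hH hd))]
  refine integral_nonneg_of_ae ?_
  filter_upwards [SqIntProgressive.ae_memLp_path hd] with ω hω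
  have hquad := inventory_quadratic (φ := φ) (ϱ := ϱ) hT hω
  simp only [kernelOp_inventoryKernel, Pi.zero_apply]
  have h1 : 0 ≤ ∫ t, (∫ s in Set.Iic t, d s ω) ^ 2 := integral_nonneg fun t => sq_nonneg _
  have h2 : ∫ t : Horizon T, d t ω * ((φ * (T - t) + ϱ) * ∫ s in Set.Iic t, d s ω)
      = ∫ t : Horizon T, (φ * (T - t) + ϱ) * (∫ s in Set.Iic t, d s ω) * d t ω :=
    integral_congr_ae (.of_forall fun t => by simp only; ring)
  rw [h2]
  nlinarith [mul_nonneg hφ h1, mul_nonneg hϱ (sq_nonneg (∫ s, d s ω))]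

/-- Strong monotonicity of the residual. -/
lemma residual_strongly_monotone (hT : 0 < T) (hφ : 0 ≤ φ) (hϱ : 0 ≤ ϱ)
    (hS : S ∈ SqIntProgressive F P) (hST : MemLp (S (terminal hT)) 2 P)
    (hg : g ∈ SqIntProgressive F P) (hG : IsAdmissibleKernel G) (hh : IsAdmissibleImpact h)
    (hA : IsMonotoneOp F P (impactOp F P h G g))
    (hu : u ∈ SqIntProgressive F P) (hd : d ∈ SqIntProgressive F P) :
    γ * ∫ p, d p.1 p.2 * d p.1 p.2 ∂(timeProd T P)
      ≤ ∫ p, residual hT F P X₀ γ φ ϱ h G g S (u + d) p.1 p.2 * d p.1 p.2 ∂(timeProd T P)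
        - ∫ p, residual hT F P X₀ γ φ ϱ h G g S u p.1 p.2 * d p.1 p.2 ∂(timeProd T P) := by
  have hH : IsAdmissibleKernel (inventoryKernel T φ ϱ) := inventoryKernel_admissible hφ hϱ
  have hv := SqIntProgressive.add hu hd
  have hAu := impactOp_mem hT hg hG hh hu
  have hAv := impactOp_mem hT hg hG hh hv
  have hadj := fun {w : RealProcess T Ω} (hw : w ∈ SqIntProgressive F P) =>
    adjointOp_spec (F := F) hT hH (SqIntProgressive.stronglyMeasurable hT hw) hw.2
  have hmono := hA (u + d) hv u hu
  have hnn := integral_mul_kernelOp_inventoryKernel_nonneg (φ := φ) (ϱ := ϱ) hT hφ hϱ hd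
  have i1 : Integrable (fun p : Horizon T × Ω => d p.1 p.2 * (impactOp F P h G g (u + d) p.1 p.2
      - impactOp F P h G g u p.1 p.2)) (timeProd T P) :=
    integrable_mul_of_mem hd (SqIntProgressive.sub hAv hAu)
  have hmono' : 0 ≤ ∫ p, d p.1 p.2 * (impactOp F P h G g (u + d) p.1 p.2
      - impactOp F P h G g u p.1 p.2) ∂(timeProd T P) := by
    rw [integral_prod_symm _ i1]
    simpa [innerL2] using hmono
  have i2 := integrable_mul_of_mem hd hd
  have i3 := integrable_mul_of_mem hd (kernelOp_mem hT hH hd)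
  have i4 := integrable_mul_of_mem (hadj hv).1 hd
  have i5 := integrable_mul_of_mem (hadj hu).1 hd
  have i6 := integrable_mul_of_mem hu (kernelOp_mem hT hH hd)
  -- Paired with `d`, duality moves the difference of the `𝐇*` terms onto `𝐇d`, so additivity of
  -- `𝐇*` itself is not needed. Together with the `𝐇` term, `𝐇 + 𝐇*` contributes `2 ⟨d, 𝐇d⟩ ≥ 0`.
  have hadj_eq : ∫ p, adjointOp F P (inventoryKernel T φ ϱ) (u + d) p.1 p.2 * d p.1 p.2
        ∂(timeProd T P)
      - ∫ p, adjointOp F P (inventoryKernel T φ ϱ) u p.1 p.2 * d p.1 p.2 ∂(timeProd T P)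
      = ∫ p, d p.1 p.2 * kernelOp (inventoryKernel T φ ϱ) d p.1 p.2 ∂(timeProd T P) := by
    have e1 := (hadj hv).2 d hd
    have e2 := (hadj hu).2 d hd
    simp only [Function.uncurry_def] at e1 e2
    rw [e1, e2, sub_eq_iff_eq_add, ← integral_add i3 i6]
    refine integral_congr_ae (.of_forall fun p => ?_)
    simp only [Pi.add_apply]
    ring
  have hres := fun {w : RealProcess T Ω} (hw : w ∈ SqIntProgressive F P) =>
    integrable_mul_of_mem (residual_mem (X₀ := X₀) (γ := γ) hT hφ hϱ hS hST hg hG hh hw) hd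
  have hlin := kernelOp_add_smul hH hu hd
  have i7 : Integrable (fun p : Horizon T × Ω => γ * (d p.1 p.2 * d p.1 p.2)
      + d p.1 p.2 * (impactOp F P h G g (u + d) p.1 p.2 - impactOp F P h G g u p.1 p.2)
      + d p.1 p.2 * kernelOp (inventoryKernel T φ ϱ) d p.1 p.2) (timeProd T P) :=
    ((i2.const_mul γ).add i1).add i3
  have i8 : Integrable (fun p : Horizon T × Ω =>
      adjointOp F P (inventoryKernel T φ ϱ) (u + d) p.1 p.2 * d p.1 p.2
      - adjointOp F P (inventoryKernel T φ ϱ) u p.1 p.2 * d p.1 p.2) (timeProd T P) := i4.sub i5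
  have expand : ∫ p, residual hT F P X₀ γ φ ϱ h G g S (u + d) p.1 p.2 * d p.1 p.2 ∂(timeProd T P)
        - ∫ p, residual hT F P X₀ γ φ ϱ h G g S u p.1 p.2 * d p.1 p.2 ∂(timeProd T P)
      = γ * (∫ p, d p.1 p.2 * d p.1 p.2 ∂(timeProd T P))
        + (∫ p, d p.1 p.2 * (impactOp F P h G g (u + d) p.1 p.2
          - impactOp F P h G g u p.1 p.2) ∂(timeProd T P))
        + (∫ p, d p.1 p.2 * kernelOp (inventoryKernel T φ ϱ) d p.1 p.2 ∂(timeProd T P))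
        + (∫ p, adjointOp F P (inventoryKernel T φ ϱ) (u + d) p.1 p.2 * d p.1 p.2 ∂(timeProd T P)
        - ∫ p, adjointOp F P (inventoryKernel T φ ϱ) u p.1 p.2 * d p.1 p.2 ∂(timeProd T P)) := by
    rw [← integral_sub (hres hv) (hres hu), ← integral_sub i4 i5, ← integral_const_mul,
      ← integral_add_three (i2.const_mul γ) i1 i3, ← integral_add i7 i8]
    refine integral_congr_ae ?_
    filter_upwards [hlin] with p hp
    have hp1 := hp 1
    rw [one_smul, one_mul] at hp1
    simp only [residual, hp1, Pi.add_apply]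
    ring
  rw [expand, hadj_eq]
  linarith

/-- Strong concavity of the performance functional. -/
lemma performance_le (hT : 0 < T) (hφ : 0 ≤ φ) (hϱ : 0 ≤ ϱ)
    (hS : S ∈ SqIntProgressive F P) (hST : MemLp (S (terminal hT)) 2 P)
    (hg : g ∈ SqIntProgressive F P) (hG : IsAdmissibleKernel G) (hh : IsAdmissibleImpact h)
    (hA : IsMonotoneOp F P (impactOp F P h G g))
    (hu : u ∈ SqIntProgressive F P) (hv : v ∈ SqIntProgressive F P) :
    performance hT P X₀ γ φ ϱ h G g S v ≤ performance hT P X₀ γ φ ϱ h G g S u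
      - ∫ p, residual hT F P X₀ γ φ ϱ h G g S u p.1 p.2 * (v p.1 p.2 - u p.1 p.2) ∂(timeProd T P)
      - γ / 2 * ∫ p, (v p.1 p.2 - u p.1 p.2) ^ 2 ∂(timeProd T P) := by
  set d : RealProcess T Ω := v - u with hd_def
  have hd : d ∈ SqIntProgressive F P := SqIntProgressive.sub hv hu
  set R : ℝ → ℝ := fun ε => ∫ p, residual hT F P X₀ γ φ ϱ h G g S (u + ε • d) p.1 p.2 * d p.1 p.2
    ∂(timeProd T P) with hR
  set D : ℝ := ∫ p, d p.1 p.2 * d p.1 p.2 ∂(timeProd T P) with hD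
  set f : ℝ → ℝ := fun ε => performance hT P X₀ γ φ ϱ h G g S (u + ε • d) with hf
  have hder : ∀ ε, HasDerivAt f (-R ε) ε := by
    intro ε
    have h1 := hasDerivAt_performance (X₀ := X₀) (γ := γ) hT hφ hϱ hS hST hg hG hh
      (SqIntProgressive.add hu (SqIntProgressive.smul ε hd)) hd
    have h3 := HasDerivAt.comp_sub_const (f := fun x : ℝ =>
      performance hT P X₀ γ φ ϱ h G g S (u + ε • d + x • d)) ε ε (by rwa [sub_self])
    refine h3.congr_of_eventuallyEq (.of_forall fun x => ?_)
    simp only [hf]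
    rw [add_assoc, ← add_smul, add_sub_cancel]
  -- Strong monotonicity for the increment `ε d`, divided by `ε`.
  have hmono : ∀ ε, 0 ≤ ε → R 0 + γ * ε * D ≤ R ε := by
    intro ε hε
    rcases hε.eq_or_lt with rfl | hε
    · simp
    have h1 := residual_strongly_monotone (X₀ := X₀) (γ := γ) hT hφ hϱ hS hST hg hG hh hA hu
      (SqIntProgressive.smul ε hd)
    simp only [Pi.smul_apply, smul_eq_mul] at h1
    have e1 : ∀ w : Horizon T × Ω → ℝ, ∫ p, w p * (ε * d p.1 p.2) ∂(timeProd T P)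
        = ε * ∫ p, w p * d p.1 p.2 ∂(timeProd T P) := by
      intro w
      rw [← integral_const_mul]
      exact integral_congr_ae (.of_forall fun p => by simp only; ring)
    have e2 : ∫ p, ε * d p.1 p.2 * (ε * d p.1 p.2) ∂(timeProd T P) = ε * (ε * D) := by
      rw [hD, ← integral_const_mul, ← integral_const_mul]
      exact integral_congr_ae (.of_forall fun p => by simp only; ring)
    rw [e1 (fun p => residual hT F P X₀ γ φ ϱ h G g S (u + ε • d) p.1 p.2),
      e1 (fun p => residual hT F P X₀ γ φ ϱ h G g S u p.1 p.2), e2] at h1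
    have h2 : R 0 = ∫ p, residual hT F P X₀ γ φ ϱ h G g S u p.1 p.2 * d p.1 p.2
        ∂(timeProd T P) := by simp only [hR, zero_smul, add_zero]
    rw [← h2, ← mul_sub] at h1
    have h3 : ε * (γ * ε * D) ≤ ε * (R ε - R 0) := by
      calc ε * (γ * ε * D) = γ * (ε * (ε * D)) := by ring
        _ ≤ _ := h1
    linarith [le_of_mul_le_mul_left h3 hε]
  -- Chosen so that `hmono` says exactly `q' ≤ 0`; the claim is `q 1 ≤ q 0`.
  set q : ℝ → ℝ := fun ε => f ε + R 0 * ε + γ / 2 * D * ε ^ 2 with hq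
  have hqder : ∀ ε, HasDerivAt q (-R ε + R 0 + γ * ε * D) ε := by
    intro ε
    have h1 := ((hder ε).add ((hasDerivAt_id ε).const_mul (R 0))).add
      ((hasDerivAt_pow 2 ε).const_mul (γ / 2 * D))
    refine h1.congr_deriv ?_
    norm_num
    ring
  have hanti : AntitoneOn q (Set.Icc 0 1) := by
    refine antitoneOn_of_deriv_nonpos (convex_Icc 0 1)
      (fun ε _ => (hqder ε).continuousAt.continuousWithinAt)
      (fun ε _ => (hqder ε).differentiableAt.differentiableWithinAt) fun ε hε => ?_
    rw [interior_Icc] at hε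
    rw [(hqder ε).deriv]
    linarith [hmono ε hε.1.le]
  have h01 := hanti (Set.left_mem_Icc.2 zero_le_one) (Set.right_mem_Icc.2 zero_le_one) zero_le_one
  have hv' : u + d = v := add_sub_cancel u v
  simp only [hq, hf, hR, zero_smul, add_zero, one_smul, hv', mul_zero, mul_one, one_pow,
    ne_eq, OfNat.ofNat_ne_zero, not_false_eq_true, zero_pow] at h01
  have hD2 : D = ∫ p, (v p.1 p.2 - u p.1 p.2) ^ 2 ∂(timeProd T P) :=
    integral_congr_ae (.of_forall fun p => (sq _).symm)
  rw [← hD2]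
  have hR2 : ∫ p, residual hT F P X₀ γ φ ϱ h G g S u p.1 p.2 * d p.1 p.2 ∂(timeProd T P)
      = ∫ p, residual hT F P X₀ γ φ ϱ h G g S u p.1 p.2 * (v p.1 p.2 - u p.1 p.2)
        ∂(timeProd T P) := rfl
  rw [← hR2]
  linarith

end Gradient

/-! ### Existence, first order condition and uniqueness -/

section Existence

/-- A strongly concave function on a Hilbert space with supergradients attains its maximum. -/
lemma exists_forall_le_of_strongly_concave {E : Type*} [NormedAddCommGroup E]
    [InnerProductSpace ℝ E] [CompleteSpace E] {J : E → ℝ} {N : E → E} {c : ℝ} (hc : 0 < c)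
    (hJ : ∀ u w, J w ≤ J u - inner ℝ (N u) (w - u) - c * ‖w - u‖ ^ 2) : ∃ u, ∀ w, J w ≤ J u := by
  have hbdd : BddAbove (Set.range J) := by
    refine ⟨J 0 + ‖N 0‖ ^ 2 / (4 * c), ?_⟩
    rintro _ ⟨w, rfl⟩
    have h1 := hJ 0 w
    rw [sub_zero] at h1
    have h2 := (abs_le.1 (abs_real_inner_le_norm (N 0) w)).1
    -- Young's inequality absorbs the linear term into the quadratic one.
    have h3 : ‖N 0‖ * ‖w‖ ≤ ‖N 0‖ ^ 2 / (4 * c) + c * ‖w‖ ^ 2 := by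
      have h4 : ‖N 0‖ ^ 2 / (4 * c) + c * ‖w‖ ^ 2 - ‖N 0‖ * ‖w‖
          = (‖N 0‖ - 2 * c * ‖w‖) ^ 2 / (4 * c) := by
        field_simp
        ring
      have h5 : 0 ≤ (‖N 0‖ - 2 * c * ‖w‖) ^ 2 / (4 * c) := by positivity
      linarith
    linarith
  set s := ⨆ w, J w with hs
  have hle : ∀ w, J w ≤ s := fun w => le_ciSup hbdd w
  have hseq : ∀ n : ℕ, ∃ u, s - 1 / ((n : ℝ) + 1) < J u := fun n =>
    exists_lt_of_lt_ciSup (sub_lt_self _ Nat.one_div_pos_of_nat)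
  choose u hu using hseq
  -- Supergradient inequalities at the midpoint `m`, added for `v` and `w`: the gradient terms are
  -- opposite and cancel. Near-maximisers are therefore close to each other.
  have hpar : ∀ v w, c / 2 * ‖v - w‖ ^ 2 ≤ 2 * s - J v - J w := by
    intro v w
    set m := (1 / 2 : ℝ) • (v + w) with hm
    have e1 : v - m = (1 / 2 : ℝ) • (v - w) := by rw [hm]; module
    have e2 : w - m = -((1 / 2 : ℝ) • (v - w)) := by rw [hm]; module
    have h1 := hJ m v
    have h2 := hJ m w
    rw [e1] at h1
    rw [e2, inner_neg_right, norm_neg] at h2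
    rw [norm_smul, Real.norm_of_nonneg (by norm_num)] at h1 h2
    linarith [hle m]
  have hcauchy : CauchySeq u := by
    refine cauchySeq_of_le_tendsto_0 (fun n : ℕ => √(4 / c * (1 / ((n : ℝ) + 1)))) ?_ ?_
    · intro n m k hn hm
      rw [dist_eq_norm]
      refine Real.le_sqrt_of_sq_le ?_
      have h1 := hpar (u n) (u m)
      have h2 : ∀ j : ℕ, k ≤ j → 1 / ((j : ℝ) + 1) ≤ 1 / ((k : ℝ) + 1) := fun j hj =>
        Nat.one_div_le_one_div hj
      have h3 : c / 2 * ‖u n - u m‖ ^ 2 ≤ 2 * (1 / ((k : ℝ) + 1)) := by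
        linarith [hu n, hu m, h2 n hn, h2 m hm]
      calc ‖u n - u m‖ ^ 2 = 2 / c * (c / 2 * ‖u n - u m‖ ^ 2) := by field_simp
        _ ≤ 2 / c * (2 * (1 / ((k : ℝ) + 1))) := by gcongr
        _ = _ := by ring
    · have h1 := (tendsto_one_div_add_atTop_nhds_zero_nat (𝕜 := ℝ)).const_mul (4 / c)
      simpa [Function.comp_def] using (Real.continuous_sqrt.tendsto _).comp h1
  obtain ⟨x, hx⟩ := cauchySeq_tendsto_of_complete hcauchy
  refine ⟨x, fun w => (hle w).trans ?_⟩
  -- No continuity of `J` is available; the supergradient inequality at the limit `x` provides the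
  -- upper semicontinuity along the sequence.
  have h1 : ∀ n : ℕ, s - 1 / ((n : ℝ) + 1) ≤ J x - inner ℝ (N x) (u n - x) := fun n => by
    have h2 := hJ x (u n)
    have h3 : 0 ≤ c * ‖u n - x‖ ^ 2 := by positivity
    linarith [hu n]
  have h2 : Tendsto (fun n : ℕ => s - 1 / ((n : ℝ) + 1)) atTop (𝓝 (s - 0)) :=
    tendsto_const_nhds.sub tendsto_one_div_add_atTop_nhds_zero_nat
  have h3 : Tendsto (fun n => J x - inner ℝ (N x) (u n - x)) atTop
      (𝓝 (J x - inner ℝ (N x) (x - x))) :=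
    tendsto_const_nhds.sub (tendsto_const_nhds.inner (hx.sub_const x))
  rw [sub_zero] at h2
  rw [sub_self, inner_zero_right, sub_zero] at h3
  exact le_of_tendsto_of_tendsto' h2 h3 h1

lemma inner_Lp_eq_integral_mul {α : Type*} [MeasurableSpace α] {μ : Measure α} {x y : Lp ℝ 2 μ}
    {f g : α → ℝ} (hx : x =ᵐ[μ] f) (hy : y =ᵐ[μ] g) : inner ℝ x y = ∫ p, f p * g p ∂μ := by
  rw [L2.inner_def]
  refine integral_congr_ae ?_
  filter_upwards [hx, hy] with p h1 h2
  rw [h1, h2]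
  simp [mul_comm]

variable {T : ℝ} {Ω : Type*} [mΩ : MeasurableSpace Ω] {P : Measure Ω} [IsProbabilityMeasure P]
  {F : Filtration (Horizon T) mΩ} {X₀ γ φ ϱ : ℝ} {h : ℝ → ℝ} {G : Horizon T → Horizon T → ℝ}
  {g S u v : RealProcess T Ω}

/-- The Hilbert space argument needs classes while `J` is defined on processes. The space `E` of
square integrable classes with a progressive representative is complete; `J` and the residual are
carried to it by chosen representatives. -/
lemma exists_isOptimal (hT : 0 < T) (hγ : 0 < γ) (hφ : 0 ≤ φ) (hϱ : 0 ≤ ϱ)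
    (hS : S ∈ SqIntProgressive F P) (hST : MemLp (S (terminal hT)) 2 P)
    (hg : g ∈ SqIntProgressive F P) (hG : IsAdmissibleKernel G) (hh : IsAdmissibleImpact h)
    (hA : IsMonotoneOp F P (impactOp F P h G g)) :
    ∃ u, IsOptimal F P (performance hT P X₀ γ φ ϱ h G g S) u := by
  have hle := progressiveSigma_le hT F
  have : Fact (progressiveSigma F ≤ Prod.instMeasurableSpace) := ⟨hle⟩
  let E := lpMeas ℝ ℝ (progressiveSigma F) 2 (timeProd T P)
  have hrep : ∀ x : E, ∃ u ∈ SqIntProgressive F P,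
      (x : Lp ℝ 2 (timeProd T P)) =ᵐ[timeProd T P] Function.uncurry u := by
    intro x
    obtain ⟨f, hf, hxf⟩ := mem_lpMeas_iff_aestronglyMeasurable.1 x.2
    refine ⟨Function.curry f, ⟨isStronglyProgressive_iff.2 ?_, ?_⟩, ?_⟩
    · rwa [Function.uncurry_curry]
    · rw [Function.uncurry_curry]
      exact (memLp_congr_ae hxf).1 (Lp.memLp _)
    · rwa [Function.uncurry_curry]
  have hclass : ∀ u ∈ SqIntProgressive F P, ∃ x : E,
      (x : Lp ℝ 2 (timeProd T P)) =ᵐ[timeProd T P] Function.uncurry u := by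
    intro u hu
    have hc := hu.2.coeFn_toLp
    exact ⟨⟨hu.2.toLp _, mem_lpMeas_iff_aestronglyMeasurable.2
      ((isStronglyProgressive_iff.1 hu.1).aestronglyMeasurable.congr hc.symm)⟩, hc⟩
  choose rep hrep_mem hrep_ae using hrep
  have hres := fun x : E => residual_mem (X₀ := X₀) (γ := γ) hT hφ hϱ hS hST hg hG hh (hrep_mem x)
  choose N hN using fun x : E => hclass _ (hres x)
  have key := fun {u v : RealProcess T Ω} (hu : u ∈ SqIntProgressive F P)
    (hv : v ∈ SqIntProgressive F P) =>
    performance_le (X₀ := X₀) (γ := γ) hT hφ hϱ hS hST hg hG hh hA hu hv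
  have hdiff : ∀ x y : E, ((y - x : E) : Lp ℝ 2 (timeProd T P)) =ᵐ[timeProd T P]
      fun p => rep y p.1 p.2 - rep x p.1 p.2 := by
    intro x y
    filter_upwards [Lp.coeFn_sub (y : Lp ℝ 2 (timeProd T P)) x, hrep_ae x, hrep_ae y]
      with p h1 h2 h3
    rw [Submodule.coe_sub, h1, Pi.sub_apply, h2, h3]
    rfl
  obtain ⟨x, hx⟩ := exists_forall_le_of_strongly_concave (E := E)
    (J := fun x => performance hT P X₀ γ φ ϱ h G g S (rep x)) (N := N) (half_pos hγ) fun x y => by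
      have h1 := key (hrep_mem x) (hrep_mem y)
      have h2 : inner ℝ (N x) (y - x) = ∫ p, residual hT F P X₀ γ φ ϱ h G g S (rep x) p.1 p.2
          * (rep y p.1 p.2 - rep x p.1 p.2) ∂(timeProd T P) :=
        inner_Lp_eq_integral_mul (hN x) (hdiff x y)
      have h3 : ‖y - x‖ ^ 2 = ∫ p, (rep y p.1 p.2 - rep x p.1 p.2) ^ 2 ∂(timeProd T P) := by
        rw [← real_inner_self_eq_norm_sq]
        refine (inner_Lp_eq_integral_mul (hdiff x y) (hdiff x y)).trans ?_
        exact integral_congr_ae (.of_forall fun p => (sq _).symm)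
      rw [h2, h3]
      exact h1
  refine ⟨rep x, hrep_mem x, fun v hv => ?_⟩
  obtain ⟨y, hy⟩ := hclass v hv
  refine le_trans ?_ (hx y)
  -- Passing to the chosen representative costs nothing: the concavity estimate between almost
  -- everywhere equal processes has vanishing error terms.
  have h1 := key (hrep_mem y) hv
  have h2 : ∀ᵐ p ∂(timeProd T P), v p.1 p.2 - rep y p.1 p.2 = 0 := by
    filter_upwards [hy, hrep_ae y] with p a1 a2
    exact sub_eq_zero.2 (a1.symm.trans a2)
  have e1 : ∫ p, residual hT F P X₀ γ φ ϱ h G g S (rep y) p.1 p.2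
      * (v p.1 p.2 - rep y p.1 p.2) ∂(timeProd T P) = 0 :=
    integral_eq_zero_of_ae (h2.mono fun p hp => by simp [hp])
  have e2 : ∫ p, (v p.1 p.2 - rep y p.1 p.2) ^ 2 ∂(timeProd T P) = 0 :=
    integral_eq_zero_of_ae (h2.mono fun p hp => by simp [hp])
  rw [e1, e2] at h1
  linarith

/-- The first order condition: optimal processes solve the Fredholm equation. -/
lemma IsOptimal.solvesFredholm (hT : 0 < T) (hφ : 0 ≤ φ) (hϱ : 0 ≤ ϱ)
    (hS : S ∈ SqIntProgressive F P) (hST : MemLp (S (terminal hT)) 2 P)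
    (hg : g ∈ SqIntProgressive F P) (hG : IsAdmissibleKernel G) (hh : IsAdmissibleImpact h)
    (hu : IsOptimal F P (performance hT P X₀ γ φ ϱ h G g S) u) :
    SolvesFredholm hT F P X₀ γ φ ϱ h G g S u := by
  refine (solvesFredholm_iff hT).2 ⟨hu.1, ?_⟩
  have hr := residual_mem (X₀ := X₀) (γ := γ) hT hφ hϱ hS hST hg hG hh hu.1
  -- Testing in the direction of the residual itself makes the derivative minus its squared norm.
  have hder := hasDerivAt_performance (X₀ := X₀) (γ := γ) hT hφ hϱ hS hST hg hG hh hu.1 hr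
  have hmax : IsLocalMax (fun ε : ℝ => performance hT P X₀ γ φ ϱ h G g S
      (u + ε • residual hT F P X₀ γ φ ϱ h G g S u)) 0 := by
    refine .of_forall fun ε => ?_
    simp only [zero_smul, add_zero]
    exact hu.2 _ (SqIntProgressive.add hu.1 (SqIntProgressive.smul ε hr))
  have h0 := neg_eq_zero.1 (hmax.hasDerivAt_eq_zero hder)
  rw [integral_eq_zero_iff_of_nonneg (fun p => mul_self_nonneg _) (integrable_mul_of_mem hr hr)]
    at h0
  exact h0.mono fun p hp => mul_self_eq_zero.1 hp

/-- A solution of the Fredholm equation is the only process with at least its performance. -/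
lemma SolvesFredholm.eqAE_of_le (hT : 0 < T) (hγ : 0 < γ) (hφ : 0 ≤ φ) (hϱ : 0 ≤ ϱ)
    (hS : S ∈ SqIntProgressive F P) (hST : MemLp (S (terminal hT)) 2 P)
    (hg : g ∈ SqIntProgressive F P) (hG : IsAdmissibleKernel G) (hh : IsAdmissibleImpact h)
    (hA : IsMonotoneOp F P (impactOp F P h G g))
    (hu : SolvesFredholm hT F P X₀ γ φ ϱ h G g S u) (hv : v ∈ SqIntProgressive F P)
    (hle : performance hT P X₀ γ φ ϱ h G g S u ≤ performance hT P X₀ γ φ ϱ h G g S v) :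
    EqAE P v u := by
  obtain ⟨hum, hu0⟩ := (solvesFredholm_iff hT).1 hu
  -- With zero residual this reads `J(v) ≤ J(u) - (γ/2) ‖v - u‖²`, and `J(u) ≤ J(v)` leaves no room
  -- for a difference.
  have h1 := performance_le (X₀ := X₀) (γ := γ) hT hφ hϱ hS hST hg hG hh hA hum hv
  have e1 : ∫ p, residual hT F P X₀ γ φ ϱ h G g S u p.1 p.2
      * (v p.1 p.2 - u p.1 p.2) ∂(timeProd T P) = 0 :=
    integral_eq_zero_of_ae (hu0.mono fun p hp => by simp [hp])
  rw [e1] at h1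
  have h2 : 0 ≤ ∫ p, (v p.1 p.2 - u p.1 p.2) ^ 2 ∂(timeProd T P) :=
    integral_nonneg fun p => sq_nonneg _
  have h3 : ∫ p, (v p.1 p.2 - u p.1 p.2) ^ 2 ∂(timeProd T P) = 0 := by
    refine le_antisymm ?_ h2
    by_contra! h4
    have := mul_pos (half_pos hγ) h4
    linarith
  have hint : Integrable (fun p : Horizon T × Ω => (v p.1 p.2 - u p.1 p.2) ^ 2) (timeProd T P) :=
    MemLp.integrable_sq (SqIntProgressive.sub hv hum).2
  rw [integral_eq_zero_iff_of_nonneg (fun p => sq_nonneg _) hint] at h3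
  exact h3.mono fun p hp => sub_eq_zero.1 (pow_eq_zero_iff two_ne_zero |>.1 hp)

end Existence

end OptimalExecution

theorem theorem2p1 {T : ℝ} (hT : 0 < T) {Ω : Type*} [mΩ : MeasurableSpace Ω]
    (P : Measure Ω) [IsProbabilityMeasure P]
    (F : Filtration (OptimalExecution.Horizon T) mΩ)
    (hF : OptimalExecution.UsualConditions F P)
    (X₀ γ φ ϱ : ℝ) (hX₀ : 0 < X₀) (hγ : 0 < γ) (hφ : 0 ≤ φ) (hϱ : 0 ≤ ϱ)
    (S : OptimalExecution.RealProcess T Ω) (hS : S ∈ OptimalExecution.SqIntProgressive F P)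
    (hST : MemLp (S (OptimalExecution.terminal hT)) 2 P)
    (g : OptimalExecution.RealProcess T Ω) (hg : g ∈ OptimalExecution.SqIntProgressive F P)
    (G : OptimalExecution.Horizon T → OptimalExecution.Horizon T → ℝ)
    (hG : OptimalExecution.IsAdmissibleKernel G)
    (h : ℝ → ℝ) (hh : OptimalExecution.IsAdmissibleImpact h)
    (hA : OptimalExecution.IsMonotoneOp F P (OptimalExecution.impactOp F P h G g)) :
    ∃ u : OptimalExecution.RealProcess T Ω,
      OptimalExecution.IsOptimal F P
        (OptimalExecution.performance hT P X₀ γ φ ϱ h G g S) u ∧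
      (∀ v, OptimalExecution.IsOptimal F P
        (OptimalExecution.performance hT P X₀ γ φ ϱ h G g S) v →
          OptimalExecution.EqAE P v u) ∧
      OptimalExecution.SolvesFredholm hT F P X₀ γ φ ϱ h G g S u ∧
      (∀ v, OptimalExecution.SolvesFredholm hT F P X₀ γ φ ϱ h G g S v →
          OptimalExecution.EqAE P v u) := by
  obtain ⟨u, hu⟩ := OptimalExecution.exists_isOptimal (X₀ := X₀) hT hγ hφ hϱ hS hST hg hG hh hA
  have hsol := OptimalExecution.IsOptimal.solvesFredholm hT hφ hϱ hS hST hg hG hh hu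
  refine ⟨u, hu, fun v hv => ?_, hsol, fun v hv => ?_⟩
  · exact OptimalExecution.SolvesFredholm.eqAE_of_le hT hγ hφ hϱ hS hST hg hG hh hA hsol hv.1
      (hv.2 u hu.1)
  -- Roles exchanged: `v` is the solution and the optimal `u` is the competitor that does at least
  -- as well.
  · exact (OptimalExecution.SolvesFredholm.eqAE_of_le hT hγ hφ hϱ hS hST hg hG hh hA hv hu.1
      (hu.2 v hv.1)).mono fun p hp => hp.symm
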